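/- Let $A$ be a finite alphabet and let $\sigma$ be a substitution over $A$, i.e. an endomorphism of the free monoid $A^*$ of finite words with $|\sigma(a)|\ge 1$ for every $a\in A$. Let $M_\sigma=(|\sigma(a)|_b)_{(b,a)\in A^2}$ be its incidence matrix, where $|\sigma(a)|_b$ is the number of occurrences of $b$ in $\sigma(a)$. Assume that - $\sigma$ is primitive: for some $n\ge 1$ all entries of $M_\sigma^n$ are positive; - $\sigma$ is proper: there are letters $a_0,a_1\in A$ such that, for every $a\in A$, the word $\sigma(a)$ starts with $a_0$ and ends with $a_1$; - $\sigma$ is pseudo-unimodular: the product of the non-zero complex eigenvalues of $M_\sigma$, counted with algebraic multiplicity, is $\pm 1$. Let $S$ be the shift map $(u_i)_{i\in\mathbb Z}\mapsto(u_{i+1})_{i\in\mathbb Z}$ of $A^{\mathbb Z}$ (with the product of the discrete topologies), and let $\Omega_\sigma\subseteq A^{\mathbb Z}$ be the smallest non-empty compact set that is invariant under $S$ and under $\sigma$. A complex number $\eta$ of modulus one is called an eigenvalue of $(\Omega_\sigma,S)$ if there is a continuous function $f:\Omega_\sigma\to\{z\in\mathbb C:|z|=1\}$ with $f\circ S=\eta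 f$. A generalized eigenvector of $M_\sigma$ for an eigenvalue $\beta\in\mathbb C$ is a non-zero vector $v\in\mathbb C^A$ in $\ker\big((M_\sigma-\beta I)^k\big)$, where $k$ is the algebraic multiplicity of $\beta$; its sum is $\sum_{a\in A}v_a$. Then, for every $\alpha\in\mathbb R$, the number $e^{2i\pi\alpha}$ is an eigenvalue of $(\Omega_\sigma,S)$ if and only if there exists a line vector $w\in\mathbb Z^A$ such that, for every generalized eigenvector $v$ of $M_\sigma$ for an eigenvalue of modulus $\ge 1$, - $wv=\alpha$ if $v$ has sum $1$, - $wv=0$ if $v$ has sum $0$. -/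

import Mathlib

/-- A substitution over the alphabet `A`: a non-erasing endomorphism of the free monoid of finite
words over `A`, given by the (non-empty) images of the letters. -/
structure Substitution (A : Type*) where
  /-- The image of a letter. -/
  image : A → List A
  /-- The substitution is non-erasing. -/
  nonerasing : ∀ a, image a ≠ []

/-- The factor `u_m u_{m+1} ⋯ u_{m+n-1}` of length `n` of a bi-infinite word `u`. -/
def biInfFactor {A : Type*} (u : ℤ → A) (m : ℤ) (n : ℕ) : List A :=
  (List.range n).map fun i : ℕ => u (m + (i : ℤ))

theorem length_biInfFactor {A : Type*} (u : ℤ → A) (m : ℤ) (n : ℕ) :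
    (biInfFactor u m n).length = n := by simp [biInfFactor]

theorem biInfFactor_add {A : Type*} (u : ℤ → A) (m : ℤ) (n k : ℕ) :
    biInfFactor u m (n + k) = biInfFactor u m n ++ biInfFactor u (m + n) k := by
  simp [biInfFactor, List.range_add, add_assoc, Function.comp_def]

theorem getElem?_biInfFactor {A : Type*} (u : ℤ → A) (m : ℤ) (n i : ℕ) (hi : i < n) :
    (biInfFactor u m n)[i]? = some (u (m + (i : ℤ))) := by
  simp [biInfFactor, hi]

namespace Substitution

variable {A : Type*} (σ : Substitution A)

/-- The action of a substitution on finite words, by concatenation. -/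
def onWord (w : List A) : List A := w.flatMap σ.image

/-- The action of a substitution on bi-infinite words:
`σ(⋯ u₋₂ u₋₁ . u₀ u₁ ⋯) = ⋯ σ(u₋₂) σ(u₋₁) . σ(u₀) σ(u₁) ⋯`.
Since `σ` is non-erasing, the letter of index `n ≥ 0` of the result is the one of index `n` in
`σ(u₀ ⋯ uₙ)`, and the letter of index `-(n+1)` is the one of index `n` from the end in
`σ(u₋₍ₙ₊₁₎ ⋯ u₋₁)`; the default value of `getD` is never used (see `onBiInf_right` and
`onBiInf_left`). -/
def onBiInf (u : ℤ → A) : ℤ → A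
  | Int.ofNat n => (σ.onWord (biInfFactor u 0 (n + 1))).getD n (u 0)
  | Int.negSucc n => (σ.onWord (biInfFactor u (-((n : ℤ) + 1)) (n + 1))).reverse.getD n (u 0)

theorem onWord_append (v w : List A) : σ.onWord (v ++ w) = σ.onWord v ++ σ.onWord w :=
  List.flatMap_append

theorem length_le_length_onWord (w : List A) : w.length ≤ (σ.onWord w).length := by
  induction w with
  | nil => simp
  | cons a w ih =>
    have h := List.length_pos_iff.2 (σ.nonerasing a)
    simp only [onWord, List.flatMap_cons, List.length_append, List.length_cons] at ih ⊢
    omega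

/-- `σ(u)`, read from the origin to the right, is `σ(u₀) σ(u₁) ⋯`. -/
theorem onBiInf_right (u : ℤ → A) (n : ℕ) :
    biInfFactor (σ.onBiInf u) 0 (σ.onWord (biInfFactor u 0 n)).length
      = σ.onWord (biInfFactor u 0 n) := by
  have key : ∀ (p q i : ℕ), p ≤ q → i < (σ.onWord (biInfFactor u 0 p)).length →
      (σ.onWord (biInfFactor u 0 q))[i]? = (σ.onWord (biInfFactor u 0 p))[i]? := by
    intro p q i hpq hi
    obtain ⟨k, rfl⟩ := Nat.exists_eq_add_of_le hpq
    rw [biInfFactor_add, onWord_append, List.getElem?_append_left hi]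
  refine List.ext_getElem? fun i => ?_
  by_cases hi : i < (σ.onWord (biInfFactor u 0 n)).length
  · have hi' : i < (σ.onWord (biInfFactor u 0 (i + 1))).length := by
      have := σ.length_le_length_onWord (biInfFactor u 0 (i + 1))
      rw [length_biInfFactor] at this
      omega
    have hv : σ.onBiInf u (i : ℤ) = (σ.onWord (biInfFactor u 0 (i + 1))).getD i (u 0) := rfl
    rw [getElem?_biInfFactor _ _ _ _ hi, zero_add, hv, ← key _ _ i (le_max_right (i + 1) n) hi,
      key _ _ i (le_max_left (i + 1) n) hi', List.getD_eq_getElem _ _ hi',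
      List.getElem?_eq_getElem hi']
  · rw [List.getElem?_eq_none (by rw [length_biInfFactor]; omega),
      List.getElem?_eq_none (by omega)]

/-- `σ(u)`, read from the origin to the left, is `⋯ σ(u₋₂) σ(u₋₁)`. -/
theorem onBiInf_left (u : ℤ → A) (n : ℕ) :
    biInfFactor (σ.onBiInf u) (-((σ.onWord (biInfFactor u (-(n : ℤ)) n)).length : ℤ))
        (σ.onWord (biInfFactor u (-(n : ℤ)) n)).length
      = σ.onWord (biInfFactor u (-(n : ℤ)) n) := by
  have key : ∀ (p q i : ℕ), p ≤ q → i < (σ.onWord (biInfFactor u (-(p : ℤ)) p)).length →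
      (σ.onWord (biInfFactor u (-(q : ℤ)) q)).reverse[i]?
        = (σ.onWord (biInfFactor u (-(p : ℤ)) p)).reverse[i]? := by
    intro p q i hpq hi
    obtain ⟨k, rfl⟩ := Nat.exists_eq_add_of_le' hpq
    have e : -((k + p : ℕ) : ℤ) + (k : ℤ) = -(p : ℤ) := by push_cast; ring
    rw [biInfFactor_add, e, onWord_append, List.reverse_append,
      List.getElem?_append_left (by simpa using hi)]
  set L := (σ.onWord (biInfFactor u (-(n : ℤ)) n)).length with hL
  refine List.ext_getElem? fun j => ?_
  by_cases hj : j < L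
  · obtain ⟨i, hi⟩ : ∃ i, L = j + i + 1 := ⟨L - j - 1, by omega⟩
    have hiL : i < (σ.onWord (biInfFactor u (-(n : ℤ)) n)).length := by omega
    have hi' : i < (σ.onWord (biInfFactor u (-((i + 1 : ℕ) : ℤ)) (i + 1))).length := by
      have := σ.length_le_length_onWord (biInfFactor u (-((i + 1 : ℕ) : ℤ)) (i + 1))
      rw [length_biInfFactor] at this
      omega
    have hv : σ.onBiInf u (Int.negSucc i)
        = (σ.onWord (biInfFactor u (-((i + 1 : ℕ) : ℤ)) (i + 1))).reverse.getD i (u 0) := rfl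
    have e : -(L : ℤ) + (j : ℤ) = Int.negSucc i := by rw [hi, Int.negSucc_eq]; push_cast; ring
    have hr : (σ.onWord (biInfFactor u (-(n : ℤ)) n))[j]?
        = (σ.onWord (biInfFactor u (-(n : ℤ)) n)).reverse[i]? := by
      rw [List.getElem?_reverse hiL]
      congr 1
      omega
    have hi'' : i < (σ.onWord (biInfFactor u (-((i + 1 : ℕ) : ℤ)) (i + 1))).reverse.length := by
      simpa using hi'
    rw [getElem?_biInfFactor _ _ _ _ hj, e, hv, hr, ← key _ _ i (le_max_right (i + 1) n) hiL,
      key _ _ i (le_max_left (i + 1) n) hi', List.getD_eq_getElem _ _ hi'',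
      List.getElem?_eq_getElem hi'']
  · rw [List.getElem?_eq_none (by rw [length_biInfFactor]; omega),
      List.getElem?_eq_none (by omega)]

/-- The incidence matrix `M_σ`: its entry in row `b` and column `a` is the number of occurrences of
the letter `b` in `σ(a)`. -/
def incidenceMatrix [DecidableEq A] : Matrix A A ℤ :=
  Matrix.of fun b a => ((σ.image a).count b : ℤ)

/-- `σ` is primitive if some power `M_σ ^ k`, `k ≥ 1`, has only positive entries. -/
def IsPrimitive [Fintype A] [DecidableEq A] : Prop := σ.incidenceMatrix.IsPrimitive

/-- `σ` is pseudo-unimodular if the product of the non-zero complex eigenvalues of `M_σ`, counted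
with algebraic multiplicity, is `1` or `-1`. -/
def IsPseudoUnimodular [Fintype A] [DecidableEq A] : Prop :=
  ((σ.incidenceMatrix.map (Int.cast : ℤ → ℂ)).charpoly.roots.filter (· ≠ 0)).prod = 1 ∨
    ((σ.incidenceMatrix.map (Int.cast : ℤ → ℂ)).charpoly.roots.filter (· ≠ 0)).prod = -1

/-- All the words `σ(a)` start with a same letter. -/
def IsLeftProper : Prop := ∃ a₀ : A, ∀ a, [a₀] <+: σ.image a

/-- All the words `σ(a)` end with a same letter. -/
def IsRightProper : Prop := ∃ a₀ : A, ∀ a, [a₀] <:+ σ.image a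

/-- `σ` is proper if it is both left-proper and right-proper. -/
def IsProper : Prop := σ.IsLeftProper ∧ σ.IsRightProper

/-- The subshift `Ω_σ`: the smallest non-empty compact (i.e. closed, the alphabet being finite)
set of bi-infinite words that is invariant under the shift map and under `σ`, obtained as the
intersection of all of them. It is meant for primitive `σ`, for which this intersection is itself
non-empty. -/
def subshift [TopologicalSpace A] : SymbolicDynamics.FullShift.Subshift A ℤ where
  carrier := ⋂ Y ∈ {Y : SymbolicDynamics.FullShift.Subshift A ℤ |
    Y.carrier.Nonempty ∧ Set.MapsTo σ.onBiInf Y.carrier Y.carrier}, Y.carrier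
  isClosed := isClosed_biInter fun Y _ => Y.isClosed
  mapsTo g _ hx := Set.mem_iInter₂.2 fun Y hY => Y.mapsTo g (Set.mem_iInter₂.1 hx Y hY)

end Substitution

/-- `η ∈ 𝕊¹` is an eigenvalue of the subshift `(Ω, S)`, with `(S u)_i = u_{i+1}`, if there is a
continuous `f : Ω → 𝕊¹` such that `f ∘ S = η f`. -/
def SymbolicDynamics.FullShift.Subshift.IsEigenvalue {A : Type*} [TopologicalSpace A]
    (Ω : SymbolicDynamics.FullShift.Subshift A ℤ) (η : Circle) : Prop :=
  ∃ f : Ω.carrier → Circle, Continuous f ∧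
    ∀ x : Ω.carrier, f ((Ω.mapsTo 1).restrict _ _ _ x) = η * f x

/-- `v` is a generalized eigenvector of the complex matrix `M` for `β`: a non-zero vector of
`ker ((M - β I) ^ k)`, where `k` is the algebraic multiplicity of `β`. (There is none if `β` is not
an eigenvalue of `M`, since then `k = 0`.) -/
def IsGeneralizedEigenvector {A : Type*} [Fintype A] [DecidableEq A] (M : Matrix A A ℂ) (β : ℂ)
    (v : A → ℂ) : Prop :=
  v ≠ 0 ∧ Matrix.mulVec ((M - Matrix.scalar A β) ^ M.charpoly.rootMultiplicity β) v = 0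

/-! By linearity the condition on `w` says that `x = w - α(1,…,1)` annihilates every generalized
eigenvector for an eigenvalue of modulus at least one; equivalently, `x M^n` tends to zero, and then
it does so summably.

From eigenvalue to `w`: properness makes the surroundings of the origin reappear in `σ^n(u)` after
`|σ^n(u₀)|` letters, so continuity of the eigenfunction gives Host's condition `η^|σ^n(a)| → 1`
(`IsProper.tendsto_pow_length`). As `(1,…,1) M^n` lists the lengths `|σ^n(a)|`, the vectors
`α(1,…,1) M^n` approach integer vectors `z n`, which eventually satisfy `z (n+1) = z n * M`.
Pseudo-unimodularity inverts `M` over `ℤ` up to its nilpotent part, so `z m` can be pulled back to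
time zero, giving `w` (`exists_int_dotProduct_eq_of_tendsto`).

From `w` to eigenvalue: summability of `x M^n` bounds the sums of `x` along admissible words
(`exists_forall_norm_sum_map_le`). The subshift is minimal, so Gottschalk–Hedlund provides a
continuous `g` with `g ∘ S = g + x(u₀)`; since `w` is integral, `exp(-2πi g)` is an eigenfunction.
-/

open Filter Topology SymbolicDynamics.FullShift

/-! ### Row vectors contracted by a matrix, and integral inversion away from zero. -/

section LinearAlgebra

open Polynomial

variable {A : Type*} [Fintype A] [DecidableEq A]

/-- A row vector which is contracted to zero by the powers of `M` annihilates all the generalized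
eigenvectors of `M` for eigenvalues of modulus at least one. -/
theorem dotProduct_eq_zero_of_tendsto_vecMul_pow {M : Matrix A A ℂ} {x : A → ℂ}
    (hx : Tendsto (fun n : ℕ => Matrix.vecMul x (M ^ n)) atTop (𝓝 0)) {β : ℂ} (hβ : 1 ≤ ‖β‖)
    (k : ℕ) (v : A → ℂ) (hv : Matrix.mulVec ((M - Matrix.scalar A β) ^ k) v = 0) :
    x ⬝ᵥ v = 0 := by
  induction k generalizing v with
  | zero => simp_all
  | succ k ih =>
    have hcomm : Commute M (M - Matrix.scalar A β) :=
      (Commute.refl M).sub_right (Matrix.scalar_commute β (fun _ => Commute.all _ _) M).symm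
    -- The vector `(M - β) v` has smaller height, so by induction `M` acts on `v` as `β` once paired
    -- with `x`.
    have step (n : ℕ) : x ⬝ᵥ Matrix.mulVec (M ^ (n + 1)) v
        = β * (x ⬝ᵥ Matrix.mulVec (M ^ n) v) := by
      have h0 : x ⬝ᵥ Matrix.mulVec (M ^ n) (Matrix.mulVec (M - Matrix.scalar A β) v) = 0 := by
        apply ih
        rw [Matrix.mulVec_mulVec, Matrix.mulVec_mulVec, ← (hcomm.pow_pow n k).eq, mul_assoc,
          ← pow_succ, ← Matrix.mulVec_mulVec, hv, Matrix.mulVec_zero]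
      rw [Matrix.sub_mulVec, Matrix.mulVec_sub, dotProduct_sub, Matrix.mulVec_mulVec, ← pow_succ,
        sub_eq_zero] at h0
      rw [h0, Matrix.scalar_apply, Matrix.diagonal_const_mulVec, Matrix.mulVec_smul,
        dotProduct_smul, smul_eq_mul]
    have hpow (n : ℕ) : x ⬝ᵥ Matrix.mulVec (M ^ n) v = β ^ n * (x ⬝ᵥ v) := by
      induction n with
      | zero => simp
      | succ n ihn => rw [step, ihn, pow_succ']; ring
    have hlim : Tendsto (fun n : ℕ => β ^ n * (x ⬝ᵥ v)) atTop (𝓝 0) := by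
      have hc : Continuous fun y : A → ℂ => y ⬝ᵥ v := by fun_prop
      have := (hc.tendsto 0).comp hx
      simpa [Function.comp_def, ← Matrix.dotProduct_mulVec, hpow] using this
    have hle : ‖x ⬝ᵥ v‖ ≤ 0 := by
      refine ge_of_tendsto' (by simpa using hlim.norm) fun n => ?_
      exact le_mul_of_one_le_left (norm_nonneg _) (one_le_pow₀ hβ)
    simpa using hle

/-- Summing the recursion bounds `(1 - r)` times each partial sum of `a` by `a 0 + ∑ b`. -/
theorem summable_of_succ_le {a b : ℕ → ℝ} {r : ℝ} (ha : ∀ n, 0 ≤ a n) (hr : r < 1)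
    (hb : Summable b) (hb0 : ∀ n, 0 ≤ b n) (h : ∀ n, a (n + 1) ≤ r * a n + b n) : Summable a := by
  refine summable_of_sum_range_le (c := (a 0 + ∑' n, b n) / (1 - r)) ha fun n => ?_
  rw [le_div_iff₀ (by linarith)]
  have h1 : ∑ i ∈ Finset.range (n + 1), a i
      ≤ a 0 + (r * ∑ i ∈ Finset.range n, a i + ∑' n, b n) := by
    rw [Finset.sum_range_succ', add_comm]
    gcongr
    calc _ ≤ ∑ i ∈ Finset.range n, (r * a i + b i) := Finset.sum_le_sum fun i _ => h i
      _ = r * ∑ i ∈ Finset.range n, a i + ∑ i ∈ Finset.range n, b i := by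
        rw [Finset.sum_add_distrib, Finset.mul_sum]
      _ ≤ _ := by
        gcongr
        exact hb.sum_le_tsum _ fun i _ => hb0 i
  rw [Finset.sum_range_succ] at h1
  linarith [ha n]

/-- The orbit of a generalized eigenvector for an eigenvalue of modulus less than one is
summable. -/
theorem summable_dotProduct_pow_mulVec {M : Matrix A A ℂ} (x : A → ℂ) {β : ℂ} (hβ : ‖β‖ < 1)
    (k : ℕ) (v : A → ℂ) (hv : Matrix.mulVec ((M - Matrix.scalar A β) ^ k) v = 0) :
    Summable fun n : ℕ => ‖x ⬝ᵥ Matrix.mulVec (M ^ n) v‖ := by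
  induction k generalizing v with
  | zero => simp_all
  | succ k ih =>
    have h' := ih (Matrix.mulVec (M - Matrix.scalar A β) v) (by
      rw [Matrix.mulVec_mulVec, ← pow_succ, hv])
    refine summable_of_succ_le (fun _ => norm_nonneg _) hβ h'
      (fun _ => norm_nonneg _) fun n => ?_
    rw [← norm_mul]
    refine le_trans (le_of_eq ?_) (norm_add_le _ _)
    congr 1
    rw [Matrix.sub_mulVec, Matrix.mulVec_sub, dotProduct_sub, Matrix.mulVec_mulVec, ← pow_succ,
      Matrix.scalar_apply, Matrix.diagonal_const_mulVec, Matrix.mulVec_smul, dotProduct_smul,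
      smul_eq_mul]
    ring

/-- The generalized eigenspaces are reached at the algebraic multiplicity. -/
theorem pow_rootMultiplicity_mulVec_eq_zero (M : Matrix A A ℂ) (β : ℂ) (k : ℕ) (v : A → ℂ)
    (hv : Matrix.mulVec ((M - Matrix.scalar A β) ^ k) v = 0) :
    Matrix.mulVec ((M - Matrix.scalar A β) ^ M.charpoly.rootMultiplicity β) v = 0 := by
  set m := M.charpoly.rootMultiplicity β with hm
  obtain ⟨q, hq, hnd⟩ := exists_eq_pow_rootMultiplicity_mul_and_not_dvd M.charpoly
    M.charpoly_monic.ne_zero β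
  rw [← hm] at hq
  have hcop : IsCoprime ((X - C β) ^ k) q :=
    ((irreducible_X_sub_C β).coprime_iff_not_dvd.2 hnd).pow_left
  obtain ⟨a, b, hab⟩ := hcop
  -- Bézout multiplied by `(X - β)^m`; Cayley–Hamilton then kills the last term at `M`.
  have key : (X - C β) ^ m = a * (X - C β) ^ m * (X - C β) ^ k + b * M.charpoly := by
    rw [hq]
    linear_combination (-(X - C β) ^ m) * hab
  have hX : aeval M (X - C β) = M - Matrix.scalar A β := by
    simp [Algebra.algebraMap_eq_smul_one, Matrix.smul_one_eq_diagonal]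
  have := congrArg (fun p => Matrix.mulVec (aeval M p) v) key
  simp only [map_add, map_mul, map_pow, hX, Matrix.aeval_self_charpoly, mul_zero, add_zero] at this
  rw [this, ← Matrix.mulVec_mulVec, hv, Matrix.mulVec_zero]

/-- A row vector annihilating the generalized eigenvectors for eigenvalues of modulus at least one
is contracted by the powers of `M`, in a summable way. -/
theorem summable_vecMul_pow {M : Matrix A A ℂ} {x : A → ℂ}
    (hx : ∀ β : ℂ, 1 ≤ ‖β‖ → ∀ v, IsGeneralizedEigenvector M β v → x ⬝ᵥ v = 0) (a : A) :
    Summable fun n : ℕ => ‖Matrix.vecMul x (M ^ n) a‖ := by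
  have key (v : A → ℂ) : Summable fun n : ℕ => ‖x ⬝ᵥ Matrix.mulVec (M ^ n) v‖ := by
    have hv : v ∈ ⨆ β, Module.End.maxGenEigenspace (Matrix.toLin' M) β := by
      rw [Module.End.iSup_maxGenEigenspace_eq_top]
      trivial
    induction hv using Submodule.iSup_induction' with
    | zero => simp
    | add v v' _ _ h h' =>
      refine Summable.of_nonneg_of_le (fun _ => norm_nonneg _) (fun n => ?_) (h.add h')
      rw [Matrix.mulVec_add, dotProduct_add]
      exact norm_add_le _ _
    | mem β v hv =>
      obtain ⟨k, hk⟩ := (Module.End.mem_maxGenEigenspace _ _ _).1 hv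
      have hk' : Matrix.mulVec ((M - Matrix.scalar A β) ^ k) v = 0 := by
        have h1 : Matrix.toLin' M - β • 1 = Matrix.toLin' (M - Matrix.scalar A β) := by
          rw [map_sub, Matrix.scalar_apply, ← Matrix.smul_one_eq_diagonal, map_smul,
            Matrix.toLin'_one]
          rfl
        rw [h1, ← Matrix.toLin'_pow, Matrix.toLin'_apply] at hk
        exact hk
      by_cases hβ : ‖β‖ < 1
      · exact summable_dotProduct_pow_mulVec x hβ k v hk'
      · convert summable_zero with n
        rw [norm_eq_zero]
        -- Generalized eigenvectors are non-zero by definition, hence the split.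
        by_cases h0 : Matrix.mulVec (M ^ n) v = 0
        · rw [h0, dotProduct_zero]
        · refine hx β (not_lt.1 hβ) _ ⟨h0, pow_rootMultiplicity_mulVec_eq_zero M β k _ ?_⟩
          have hcomm : Commute M (M - Matrix.scalar A β) :=
            (Commute.refl M).sub_right (Matrix.scalar_commute β (fun _ => Commute.all _ _) M).symm
          rw [Matrix.mulVec_mulVec, ← (hcomm.pow_pow n k).eq, ← Matrix.mulVec_mulVec, hk',
            Matrix.mulVec_zero]
  convert key (Pi.single a 1) using 3 with n
  rw [Matrix.dotProduct_mulVec, dotProduct_single_one]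

/-- A matrix `M` of integers whose non-zero eigenvalues have product `±1` is invertible over `ℤ`
up to its nilpotent part. -/
theorem exists_commute_mul_pow_succ_eq_pow (M : Matrix A A ℤ)
    (h : ((M.map (Int.cast : ℤ → ℂ)).charpoly.roots.filter (· ≠ 0)).prod = 1 ∨
      ((M.map (Int.cast : ℤ → ℂ)).charpoly.roots.filter (· ≠ 0)).prod = -1) :
    ∃ (N : Matrix A A ℤ) (k : ℕ), Commute N M ∧ N * M ^ (k + 1) = M ^ k := by
  set p := (M.map (Int.cast : ℤ → ℂ)).charpoly with hp
  have hpM : p = M.charpoly.map (Int.castRingHom ℂ) := by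
    rw [hp, ← Matrix.charpoly_map]; rfl
  have hmonic : p.Monic := Matrix.charpoly_monic _
  set s := p.roots.filter (· ≠ 0) with hs
  set k := (p.roots.filter (¬ · ≠ 0)).card with hk
  set Q : ℂ[X] := (s.map fun r => X - C r).prod with hQ
  have hfac : p = X ^ k * Q := by
    have h1 := (IsAlgClosed.splits p).eq_prod_roots_of_monic hmonic
    have h2 : p.roots = s + p.roots.filter (¬ · ≠ 0) := (Multiset.filter_add_not _ _).symm
    rw [h1, h2, Multiset.map_add, Multiset.prod_add, mul_comm]
    congr 1
    rw [Multiset.map_congr (g := fun _ => X) rfl, Multiset.map_const', Multiset.prod_replicate]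
    intro r hr
    have : r = 0 := by simpa using (Multiset.mem_filter.1 hr).2
    simp [this]
  have hQ0 : Q.coeff 0 = 1 ∨ Q.coeff 0 = -1 := by
    have : Q.coeff 0 = (-1) ^ s.card * s.prod := by
      rw [coeff_zero_eq_eval_zero, hQ, eval_multiset_prod, Multiset.map_map]
      simp [Multiset.prod_map_neg]
    rw [this]
    rcases neg_one_pow_eq_or ℂ s.card with e | e <;> rcases h with h | h <;> simp [e, h]
  -- The factorization `X^k * Q` with `Q(0) = ±1` descends to `ℤ[X]`.
  have hdvd : (X : ℤ[X]) ^ k ∣ M.charpoly := by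
    rw [X_pow_dvd_iff]
    intro d hd
    have h1 : p.coeff d = 0 := by
      rw [hfac]; exact X_pow_dvd_iff.1 (dvd_mul_right _ _) d hd
    rw [hpM, coeff_map] at h1
    simpa using h1
  obtain ⟨P, hP⟩ := hdvd
  have hP0 : P.coeff 0 * P.coeff 0 = 1 := by
    have h1 : ((P.coeff 0 : ℤ) : ℂ) = Q.coeff 0 := by
      have h2 := congrArg (fun q => coeff q k) (hpM.symm.trans hfac)
      simp only [hP, Polynomial.map_mul, Polynomial.map_pow, map_X] at h2
      rw [coeff_X_pow_mul', coeff_X_pow_mul'] at h2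
      simpa using h2
    have h3 : ((P.coeff 0 : ℤ) : ℂ) * (P.coeff 0 : ℤ) = 1 := by
      rcases hQ0 with e | e <;> simp [h1, e]
    exact_mod_cast h3
  have hPM : M ^ k * aeval M P = 0 := by
    have := Matrix.aeval_self_charpoly M
    rwa [hP, map_mul, map_pow, aeval_X] at this
  have hPd : aeval M P = M * aeval M P.divX + algebraMap ℤ _ (P.coeff 0) := by
    conv_lhs => rw [← X_mul_divX_add P]
    simp
  have hcomm (q : ℤ[X]) : Commute (aeval M q) M := by
    have := Polynomial.commute_X q
    simpa using (this.map (aeval M)).symm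
  -- Writing `P = X * P.divX + P(0)`, the relation `M^k P(M) = 0` gives `M^(k+1) P.divX(M) = -P(0)
  -- M^k`, and `P(0)^2 = 1`.
  refine ⟨aeval M (C (-P.coeff 0) * P.divX), k, hcomm _, ?_⟩
  have e1 : M ^ k * (M * aeval M P.divX) = -(M ^ k * algebraMap ℤ _ (P.coeff 0)) := by
    rw [hPd, mul_add] at hPM
    exact eq_neg_of_add_eq_zero_left hPM
  rw [((hcomm (C (-P.coeff 0) * P.divX)).pow_right (k + 1)).eq, pow_succ, mul_assoc, map_mul,
    aeval_C, map_neg, neg_mul, mul_neg, mul_neg, ← mul_assoc M, ← Algebra.commutes, mul_assoc,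
    ← mul_assoc (M ^ k), ← Algebra.commutes, mul_assoc, e1, mul_neg, neg_neg,
    ← Algebra.commutes (P.coeff 0) (M ^ k), ← mul_assoc, ← map_mul, hP0, map_one, one_mul]

end LinearAlgebra

/-! ### Factors of concatenations and occurrences in bi-infinite words. -/

theorem List.exists_infix_of_prefix_flatMap {A B : Type*} {g : B → List A} {L : ℕ}
    (hg : ∀ b, (g b).length ≤ L) {w : List A} (hw : L ≤ w.length) (hw0 : w ≠ []) {l : List B}
    (h : w <+: l.flatMap g) : ∃ b, g b <:+: w := by
  cases l with
  | nil => simp_all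
  | cons b l =>
    refine ⟨b, (List.prefix_of_prefix_length_le (List.prefix_append _ _) h
      ((hg b).trans hw)).isInfix⟩

/-- The block in which `w` starts covers at most `L` of its letters; more than `L` remain, enough
for the whole next block. -/
theorem List.exists_infix_of_infix_flatMap {A B : Type*} {g : B → List A} {L : ℕ}
    (hg : ∀ b, (g b).length ≤ L) {w : List A} (hw : 2 * L < w.length) {l : List B}
    (h : w <:+: l.flatMap g) : ∃ b, g b <:+: w := by
  induction l with
  | nil =>
    have := h.length_le
    simp only [List.flatMap_nil, List.length_nil] at this
    omega
  | cons b l ih =>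
    obtain ⟨s, t, hst⟩ := h
    rw [List.flatMap_cons, List.append_assoc, List.append_eq_append_iff] at hst
    rcases hst with ⟨r, hr, hr'⟩ | ⟨r, hr, hr'⟩
    · have hrL : r.length ≤ L := by
        have := congrArg List.length hr
        rw [List.length_append] at this
        have := hg b
        omega
      rw [List.append_eq_append_iff] at hr'
      rcases hr' with ⟨r', hr', -⟩ | ⟨r', hr', hr''⟩
      · have := congrArg List.length hr'
        rw [List.length_append] at this
        omega
      · have hlen := congrArg List.length hr'
        rw [List.length_append] at hlen
        obtain ⟨c, hc⟩ := List.exists_infix_of_prefix_flatMap hg (w := r') (by omega)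
          (List.ne_nil_of_length_pos (by omega)) (l := l) ⟨t, hr''.symm⟩
        exact ⟨c, hc.trans (by rw [hr']; exact (List.suffix_append _ _).isInfix)⟩
    · exact ih ⟨r, t, by rw [List.append_assoc, hr']⟩

/-- The word `w` occurs in the bi-infinite word `u` at the position `m`. -/
def OccursAt {A : Type*} (u : ℤ → A) (m : ℤ) (w : List A) : Prop :=
  biInfFactor u m w.length = w

section OccursAt

variable {A : Type*} {u : ℤ → A} {m : ℤ} {v w : List A}

theorem occursAt_biInfFactor (u : ℤ → A) (m : ℤ) (n : ℕ) : OccursAt u m (biInfFactor u m n) := by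
  rw [OccursAt, length_biInfFactor]

theorem occursAt_append :
    OccursAt u m (v ++ w) ↔ OccursAt u m v ∧ OccursAt u (m + v.length) w := by
  rw [OccursAt, List.length_append, biInfFactor_add]
  exact ⟨fun h => List.append_inj h (length_biInfFactor _ _ _), fun h => by rw [h.1, h.2]⟩

theorem OccursAt.exists_of_infix (hw : OccursAt u m w) (h : v <:+: w) : ∃ p, OccursAt u p v := by
  obtain ⟨s, t, rfl⟩ := h
  exact ⟨_, (occursAt_append.1 (occursAt_append.1 hw).1).2⟩

theorem occursAt_iff :
    OccursAt u m w ↔ ∀ (i : ℕ) (hi : i < w.length), u (m + i) = w[i] := by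
  constructor
  · intro h i hi
    have := getElem?_biInfFactor u m w.length i hi
    rw [h, List.getElem?_eq_getElem hi] at this
    exact (Option.some.inj this).symm
  · intro h
    refine List.ext_getElem (length_biInfFactor _ _ _) fun i _ hi => ?_
    rw [← h i hi]
    simp [biInfFactor]

theorem biInfFactor_congr {u v : ℤ → A} {p q : ℤ} {n : ℕ}
    (h : ∀ i : ℕ, i < n → u (p + i) = v (q + i)) : biInfFactor u p n = biInfFactor v q n := by
  refine List.map_congr_left fun i hi => h i (List.mem_range.1 hi)

theorem biInfFactor_shift (u : ℤ → A) (g m : ℤ) (n : ℕ) :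
    biInfFactor (SymbolicDynamics.FullShift.shift g u) m n = biInfFactor u (g + m) n :=
  biInfFactor_congr fun i _ => by rw [SymbolicDynamics.FullShift.shift_apply, add_assoc]

theorem biInfFactor_infix (u : ℤ → A) {m p : ℤ} {n q : ℕ} (h1 : p ≤ m) (h2 : m + n ≤ p + q) :
    biInfFactor u m n <:+: biInfFactor u p q := by
  obtain ⟨i, rfl⟩ := Int.le.dest h1
  obtain ⟨j, rfl⟩ : ∃ j, q = i + n + j := ⟨q - i - n, by omega⟩
  rw [biInfFactor_add, biInfFactor_add]
  exact List.infix_append _ _ _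

theorem isClopen_setOf_biInfFactor [Finite A] [TopologicalSpace A] [DiscreteTopology A]
    (P : List A → Prop) (m : ℤ) (n : ℕ) : IsClopen {u : ℤ → A | P (biInfFactor u m n)} := by
  have hc : Continuous fun (u : ℤ → A) (i : Fin n) => u (m + (i : ℤ)) := by fun_prop
  have := (isClopen_discrete {f : Fin n → A | P (List.ofFn f)}).preimage hc
  convert this using 1
  ext u
  simp only [Set.mem_ofPred_eq, Set.mem_preimage]
  congr! 1
  refine List.ext_getElem (by simp [biInfFactor]) fun i _ _ => by simp [biInfFactor]

theorem tendsto_of_forall_abs_le [TopologicalSpace A] {x : ℕ → ℤ → A} {y : ℤ → A}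
    (h : ∀ (n : ℕ) (i : ℤ), |i| ≤ n → x n i = y i) : Tendsto x atTop (𝓝 y) := by
  refine tendsto_pi_nhds.2 fun i => tendsto_const_nhds.congr' ?_
  filter_upwards [eventually_ge_atTop i.natAbs] with n hn
  exact (h n i (by rw [Int.abs_eq_natAbs]; omega)).symm

theorem eventually_forall_abs_le [TopologicalSpace A] [DiscreteTopology A] (y : ℤ → A) (n : ℕ) :
    ∀ᶠ x in 𝓝 y, ∀ i : ℤ, |i| ≤ n → x i = y i := by
  have h (i : ℤ) : ∀ᶠ x in 𝓝 y, x i = y i := by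
    have hc : Continuous fun x : ℤ → A => x i := continuous_apply i
    exact ((isOpen_discrete {y i}).preimage hc).mem_nhds rfl
  have := (Filter.eventually_all_finset (Finset.Icc (-(n : ℤ)) n)).2 fun i _ => h i
  filter_upwards [this] with x hx i hi
  exact hx i (Finset.mem_Icc.2 (abs_le.1 hi))

end OccursAt

/-! ### Iterates of a substitution on words, and the incidence matrix. -/

namespace Substitution

variable {A : Type*} (σ : Substitution A)

theorem iterate_onWord_append (n : ℕ) (v w : List A) :
    σ.onWord^[n] (v ++ w) = σ.onWord^[n] v ++ σ.onWord^[n] w := by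
  induction n with
  | zero => rfl
  | succ n ih => simp only [Function.iterate_succ_apply', ih, onWord_append]

theorem iterate_onWord_infix (n : ℕ) {v w : List A} (h : v <:+: w) :
    σ.onWord^[n] v <:+: σ.onWord^[n] w := by
  obtain ⟨s, t, rfl⟩ := h
  rw [iterate_onWord_append, iterate_onWord_append]
  exact List.infix_append _ _ _

theorem iterate_onWord_flatMap (n : ℕ) (w : List A) :
    σ.onWord^[n] w = w.flatMap fun a => σ.onWord^[n] [a] := by
  induction w with
  | nil => induction n with
    | zero => rfl
    | succ n ih => rw [Function.iterate_succ_apply', ih]; rfl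
  | cons a w ih => rw [List.flatMap_cons, ← ih, ← iterate_onWord_append]; rfl

theorem length_iterate_onWord_mono (w : List A) : Monotone fun n => (σ.onWord^[n] w).length :=
  monotone_nat_of_le_succ fun n => by
    rw [Function.iterate_succ_apply']
    exact σ.length_le_length_onWord _

theorem iterate_succ_onWord_singleton (n : ℕ) (a : A) :
    σ.onWord^[n + 1] [a] = σ.onWord^[n] (σ.image a) := by
  rw [Function.iterate_succ_apply]
  simp [onWord]

section Matrix

variable [Fintype A] [DecidableEq A] {R : Type*} [CommRing R]

theorem sum_map_onWord (x : A → R) (w : List A) :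
    ((σ.onWord w).map x).sum
      = (w.map (Matrix.vecMul x (σ.incidenceMatrix.map (Int.cast : ℤ → R)))).sum := by
  induction w with
  | nil => simp [onWord]
  | cons a w ih =>
    have h : σ.onWord (a :: w) = σ.image a ++ σ.onWord w := List.flatMap_cons
    rw [h, List.map_append, List.sum_append, ih, List.map_cons, List.sum_cons,
      Finset.sum_list_map_count]
    congr 1
    rw [Finset.sum_subset (Finset.subset_univ _)]
    · simp [Matrix.vecMul, dotProduct, incidenceMatrix, mul_comm]
    · intro b _ hb
      rw [List.count_eq_zero_of_not_mem (by simpa using hb), zero_smul]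

/-- This turns row vectors `x M^n` into sums of `x` along `σ^n(w)`; a constant `x` measures lengths.
-/
theorem sum_map_iterate_onWord (x : A → R) (n : ℕ) (w : List A) :
    ((σ.onWord^[n] w).map x).sum
      = (w.map (Matrix.vecMul x (σ.incidenceMatrix.map (Int.cast : ℤ → R) ^ n))).sum := by
  induction n generalizing w with
  | zero => simp
  | succ n ih =>
    rw [Function.iterate_succ_apply, ih, sum_map_onWord, Matrix.vecMul_vecMul, pow_succ]

variable {σ}

theorem IsPrimitive.exists_forall_mem (h : σ.IsPrimitive) :
    ∃ k, ∀ n, k ≤ n → ∀ a b, b ∈ σ.onWord^[n] [a] := by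
  obtain ⟨k, -, hk⟩ := h.2
  refine ⟨k, fun n hn => ?_⟩
  induction n, hn using Nat.le_induction with
  | base =>
    intro a b
    by_contra hb
    have h1 := σ.sum_map_iterate_onWord (Pi.single b (1 : ℤ)) k [a]
    -- If `b` were missing from `σ^k(a)`, the sum of its indicator, which is the entry `(b, a)` of
    -- `M^k`, would vanish.
    rw [List.sum_eq_zero] at h1
    · have h2 := hk b a
      simp only [List.map_cons, List.map_nil, List.sum_singleton, Matrix.single_one_vecMul,
        Matrix.row_apply] at h1
      have h3 : σ.incidenceMatrix.map (Int.cast : ℤ → ℤ) = σ.incidenceMatrix := by ext; simp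
      rw [h3] at h1
      omega
    · intro z hz
      obtain ⟨c, hc, rfl⟩ := List.mem_map.1 hz
      refine Pi.single_eq_of_ne ?_ _
      rintro rfl
      exact hb hc
  | succ n _ ih =>
    intro a b
    obtain ⟨c, l, hc⟩ := List.exists_cons_of_ne_nil (σ.nonerasing a)
    rw [iterate_succ_onWord_singleton, iterate_onWord_flatMap]
    exact List.mem_flatMap.2 ⟨c, by simp [hc], ih c b⟩

/-- Some `σ^k(a)` contains two distinct letters for every `a`, so `σ^k` at least doubles lengths.
The identity on one letter shows why `A` has to be nontrivial. -/
theorem IsPrimitive.exists_le_length [Nontrivial A] (h : σ.IsPrimitive) (L : ℕ) :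
    ∃ k, ∀ n, k ≤ n → ∀ a, L ≤ (σ.onWord^[n] [a]).length := by
  obtain ⟨k, hk⟩ := h.exists_forall_mem
  have h2 (a : A) : 2 ≤ (σ.onWord^[k] [a]).length := by
    obtain ⟨b, c, hbc⟩ := exists_pair_ne A
    have hb := hk k le_rfl a b
    have hc := hk k le_rfl a c
    by_contra! hl
    have : (σ.onWord^[k] [a]).length = 1 := by
      have := List.length_pos_of_mem hb
      omega
    obtain ⟨d, hd⟩ := List.length_eq_one_iff.1 this
    simp_all
  have h2' (w : List A) : 2 * w.length ≤ (σ.onWord^[k] w).length := by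
    rw [iterate_onWord_flatMap, List.length_flatMap]
    induction w with
    | nil => simp
    | cons a w ih =>
      rw [List.map_cons, List.sum_cons, List.length_cons]
      have := h2 a
      omega
  have h3 (m : ℕ) (a : A) : m + 1 ≤ (σ.onWord^[k * m] [a]).length := by
    induction m with
    | zero => simp
    | succ m ih =>
      rw [Nat.mul_succ, Nat.add_comm (k * m) k, Function.iterate_add_apply]
      have := h2' (σ.onWord^[k * m] [a])
      omega
  exact ⟨k * L, fun n hn a => ((Nat.le_succ L).trans (h3 L a)).trans
    (σ.length_iterate_onWord_mono [a] hn)⟩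

end Matrix

/-- A word is admissible if it is a factor of some `σ^k(a)`. -/
def Admissible (w : List A) : Prop := ∃ k a, w <:+: σ.onWord^[k] [a]

variable {σ}

theorem Admissible.of_infix {v w : List A} (hw : σ.Admissible w) (h : v <:+: w) :
    σ.Admissible v := by
  obtain ⟨k, a, hk⟩ := hw
  exact ⟨k, a, h.trans hk⟩

theorem Admissible.onWord {w : List A} (hw : σ.Admissible w) : σ.Admissible (σ.onWord w) := by
  obtain ⟨k, a, hk⟩ := hw
  refine ⟨k + 1, a, ?_⟩
  rw [Function.iterate_succ_apply']
  exact σ.iterate_onWord_infix 1 hk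

theorem occursAt_onBiInf {u : ℤ → A} {w : List A} (h : OccursAt u 0 w) :
    OccursAt (σ.onBiInf u) 0 (σ.onWord w) := by
  have := σ.onBiInf_right u w.length
  rwa [show biInfFactor u 0 w.length = w from h] at this

theorem occursAt_onBiInf_neg {u : ℤ → A} {w : List A} (h : OccursAt u (-(w.length : ℤ)) w) :
    OccursAt (σ.onBiInf u) (-((σ.onWord w).length : ℤ)) (σ.onWord w) := by
  have := σ.onBiInf_left u w.length
  rwa [show biInfFactor u (-(w.length : ℤ)) w.length = w from h] at this

theorem occursAt_iterate_onBiInf {u : ℤ → A} {w : List A} (h : OccursAt u 0 w) (n : ℕ) :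
    OccursAt (σ.onBiInf^[n] u) 0 (σ.onWord^[n] w) := by
  induction n with
  | zero => exact h
  | succ n ih =>
    rw [Function.iterate_succ_apply', Function.iterate_succ_apply']
    exact occursAt_onBiInf ih

theorem occursAt_iterate_onBiInf_neg {u : ℤ → A} {w : List A}
    (h : OccursAt u (-(w.length : ℤ)) w) (n : ℕ) :
    OccursAt (σ.onBiInf^[n] u) (-((σ.onWord^[n] w).length : ℤ)) (σ.onWord^[n] w) := by
  induction n with
  | zero => exact h
  | succ n ih =>
    rw [Function.iterate_succ_apply', Function.iterate_succ_apply']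
    exact occursAt_onBiInf_neg ih

/-- Every factor of `σ(u)` is a factor of the image of a factor of `u`. -/
theorem biInfFactor_onBiInf_infix (u : ℤ → A) (m : ℤ) (n : ℕ) :
    ∃ p q, biInfFactor (σ.onBiInf u) m n <:+: σ.onWord (biInfFactor u p q) := by
  -- Images are no shorter than words, so the image of the window `[-N, N)` covers `[-N, N)`, hence
  -- the factor.
  set N := m.natAbs + n
  set v := biInfFactor u (-(N : ℤ)) N with hv
  set w := biInfFactor u 0 N with hw
  have hvl : v.length = N := length_biInfFactor _ _ _
  have hwl : w.length = N := length_biInfFactor _ _ _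
  have h1 : OccursAt (σ.onBiInf u) _ (σ.onWord v) :=
    occursAt_onBiInf_neg (by rw [hvl]; exact occursAt_biInfFactor _ _ _)
  have h2 : OccursAt (σ.onBiInf u) 0 (σ.onWord w) :=
    occursAt_onBiInf (occursAt_biInfFactor _ _ _)
  have h3 := occursAt_append.2 ⟨h1, by rw [neg_add_cancel]; exact h2⟩
  have hvL := σ.length_le_length_onWord v
  have hwL := σ.length_le_length_onWord w
  refine ⟨-(N : ℤ), N + N, ?_⟩
  rw [biInfFactor_add, neg_add_cancel, ← hv, ← hw, onWord_append, ← h3]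
  refine biInfFactor_infix _ ?_ ?_
  · omega
  · rw [List.length_append]; push_cast; omega

end Substitution

/-! ### Asymptotically integral orbits and distance to the nearest integer. -/

section IntegerApproximation

variable {A : Type*} [Fintype A] [DecidableEq A]

/-- If the vectors `y M^n` are asymptotically integral, then `y` agrees with an integer vector on
the generalized eigenvectors of `M` for eigenvalues of modulus at least one. -/
theorem exists_int_dotProduct_eq_of_tendsto (M : Matrix A A ℤ)
    (h : ((M.map (Int.cast : ℤ → ℂ)).charpoly.roots.filter (· ≠ 0)).prod = 1 ∨
      ((M.map (Int.cast : ℤ → ℂ)).charpoly.roots.filter (· ≠ 0)).prod = -1)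
    (y : A → ℂ) (z : ℕ → A → ℤ)
    (hz : Tendsto (fun n => Matrix.vecMul y (M.map (Int.cast : ℤ → ℂ) ^ n)
      - fun a => (z n a : ℂ)) atTop (𝓝 0)) :
    ∃ w : A → ℤ, ∀ β : ℂ, 1 ≤ ‖β‖ → ∀ v,
      IsGeneralizedEigenvector (M.map (Int.cast : ℤ → ℂ)) β v →
        (fun a => (w a : ℂ)) ⬝ᵥ v = y ⬝ᵥ v := by
  obtain ⟨N, k, hNM, hN⟩ := exists_commute_mul_pow_succ_eq_pow M h
  have hpow (n : ℕ) : N ^ n * M ^ (k + n) = M ^ k := by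
    induction n with
    | zero => simp
    | succ n ih =>
      rw [pow_succ, mul_assoc, ← add_assoc, Nat.add_right_comm, pow_add, ← mul_assoc N, hN,
        ← pow_add, ih]
  let c : Matrix A A ℤ →+* Matrix A A ℂ := (Int.castRingHom ℂ).mapMatrix
  have hc (P : Matrix A A ℤ) : P.map (Int.cast : ℤ → ℂ) = c P := rfl
  rw [hc] at hz ⊢
  have hcast (x : A → ℤ) (P : Matrix A A ℤ) :
      (fun a => ((Matrix.vecMul x P a : ℤ) : ℂ)) = Matrix.vecMul (fun a => (x a : ℂ)) (c P) := by
    ext a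
    exact RingHom.map_vecMul (Int.castRingHom ℂ) P x a
  -- The difference of the two sides is an integer vector tending to zero.
  have hev : ∀ᶠ n in atTop, z (n + 1) = Matrix.vecMul (z n) M := by
    have hcont : Continuous fun x : A → ℂ => Matrix.vecMul x (c M) := by fun_prop
    have h1 := ((hcont.tendsto 0).comp hz).sub (hz.comp (tendsto_add_atTop_nat 1))
    have h2 (a : A) := (tendsto_pi_nhds.1 h1) a
    have h3 : ∀ᶠ n in atTop, ∀ a, z (n + 1) a = Matrix.vecMul (z n) M a := by
      refine eventually_all.2 fun a => ?_
      have h4 := (h2 a).norm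
      simp only [Matrix.zero_vecMul, sub_self, Pi.zero_apply, norm_zero] at h4
      filter_upwards [h4.eventually_lt_const one_pos] with n hn
      simp only [Function.comp_apply, Matrix.sub_vecMul, Matrix.vecMul_vecMul, ← pow_succ,
        ← hcast, Pi.sub_apply] at hn
      rw [sub_sub_sub_cancel_left, ← Int.cast_sub, Complex.norm_intCast] at hn
      have : |z (n + 1) a - Matrix.vecMul (z n) M a| < 1 := by exact_mod_cast hn
      exact sub_eq_zero.1 (Int.abs_lt_one_iff.1 this)
    filter_upwards [h3] with n hn using funext hn
  obtain ⟨m, hm⟩ := eventually_atTop.1 hev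
  have hzm (j : ℕ) : z (m + j) = Matrix.vecMul (z m) (M ^ j) := by
    induction j with
    | zero => simp
    | succ j ih => rw [← add_assoc, hm _ (by omega), ih, Matrix.vecMul_vecMul, pow_succ]
  -- `N^m` plays the role of `M^(-m)`. It inverts `M^m` only after multiplication by `M^k`, hence
  -- the shift of the limit by `k` below.
  refine ⟨Matrix.vecMul (z m) (N ^ m), fun β hβ v hv => ?_⟩
  rw [← sub_eq_zero, ← sub_dotProduct]
  refine dotProduct_eq_zero_of_tendsto_vecMul_pow (M := c M) ?_ hβ _ v hv.2
  refine (tendsto_add_atTop_iff_nat k).1 ?_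
  have hcont : Continuous fun x : A → ℂ => -Matrix.vecMul x (c (N ^ m)) := by fun_prop
  have h1 := (hcont.tendsto 0).comp (hz.comp (tendsto_add_atTop_nat (m + k)))
  simp only [Matrix.zero_vecMul, neg_zero] at h1
  refine h1.congr fun j => ?_
  have e0 : j + (m + k) = m + (j + k) := by omega
  have e1 : c M ^ (m + (j + k)) * c (N ^ m) = c M ^ (j + k) := by
    rw [← map_pow, ← map_pow, ← map_mul, ((hNM.pow_pow m _).eq).symm,
      show m + (j + k) = (k + m) + j by omega, pow_add, ← mul_assoc, hpow, ← pow_add, add_comm]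
  simp only [Function.comp_apply]
  rw [e0, Matrix.sub_vecMul, Matrix.vecMul_vecMul, e1, hzm, hcast, hcast, Matrix.vecMul_vecMul,
    Matrix.sub_vecMul, Matrix.vecMul_vecMul, neg_sub, ← map_pow, ← map_mul, ← map_mul,
    (hNM.pow_pow m (j + k)).eq]

/-- With `s = t - round t`, the chord is `2|sin πs|`, and `|sin y| ≥ 2|y|/π` for `|y| ≤ π/2`. -/
theorem Circle.four_mul_abs_sub_round_le (t : ℝ) :
    4 * |t - round t| ≤ dist (Circle.exp (2 * Real.pi * t)) 1 := by
  set s := t - round t with hs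
  have hs2 : |s| ≤ 1 / 2 := abs_sub_round t
  have e : Circle.exp (2 * Real.pi * t) = Circle.exp (2 * Real.pi * s) := by
    have : 2 * Real.pi * t = 2 * Real.pi * s + 2 * Real.pi * round t := by rw [hs]; ring
    rw [this, Circle.exp_add, mul_comm (2 * Real.pi) ((round t : ℤ) : ℝ),
      Circle.exp_int_mul_two_pi, mul_one]
  have h1 : dist (Circle.exp (2 * Real.pi * s)) 1 = 2 * |Real.sin (Real.pi * s)| := by
    change dist ((Circle.exp (2 * Real.pi * s) : Circle) : ℂ) ((1 : Circle) : ℂ) = _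
    rw [Circle.coe_exp, Circle.coe_one, dist_eq_norm, mul_comm _ Complex.I,
      Complex.norm_exp_I_mul_ofReal_sub_one, norm_mul, Real.norm_eq_abs, Real.norm_eq_abs, abs_two]
    congr 3
    ring
  have h2 : |Real.pi * s| ≤ Real.pi / 2 := by
    rw [abs_mul, abs_of_pos Real.pi_pos]
    nlinarith [Real.pi_pos]
  have h3 := Real.mul_abs_le_abs_sin h2
  rw [abs_mul, abs_of_pos Real.pi_pos] at h3
  have h4 : 2 / Real.pi * (Real.pi * |s|) = 2 * |s| := by field_simp
  rw [e, h1]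
  linarith

theorem Circle.dist_mul_right (a b c : Circle) : dist (a * c) (b * c) = dist a b := by
  change dist ((a * c : Circle) : ℂ) ((b * c : Circle) : ℂ) = dist (a : ℂ) (b : ℂ)
  rw [Circle.coe_mul, Circle.coe_mul, dist_eq_norm, ← sub_mul, norm_mul, Circle.norm_coe, mul_one,
    dist_eq_norm]

end IntegerApproximation

/-! ### Approximation by central windows in a subshift. -/

namespace SymbolicDynamics.FullShift.Subshift

variable {A : Type*} [TopologicalSpace A]

theorem mem_of_forall_occursAt (Y : Subshift A ℤ) {x : ℤ → A}
    (h : ∀ n : ℕ, ∃ y ∈ Y.carrier, ∃ p, OccursAt y p (biInfFactor x (-(n : ℤ)) (2 * n + 1))) :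
    x ∈ Y.carrier := by
  choose y hy p hp using h
  refine Y.isClosed.mem_of_tendsto (tendsto_of_forall_abs_le (y := x)
    -- The window of `x` starts at `-n`, so this shift moves its occurrence at `p n` back to that
    -- place.
    (x := fun n => shift (p n + n) (y n)) fun n i hi => ?_)
    (Eventually.of_forall fun n => Y.mapsTo _ (hy n))
  have hi' := abs_le.1 hi
  have h1 := occursAt_iff.1 (hp n) (i + n).toNat (by rw [length_biInfFactor]; omega)
  have h2 : (((i + n).toNat : ℕ) : ℤ) = i + n := Int.toNat_of_nonneg (by omega)
  rw [h2] at h1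
  rw [shift_apply, show p n + n + i = p n + (i + n) by ring, h1]
  simp only [biInfFactor, List.getElem_map, List.getElem_range, h2]
  congr 1
  ring

/-- Uniform continuity on a compact space, closeness being agreement on a central window. -/
theorem exists_forall_dist_lt [Finite A] [DiscreteTopology A] (Ω : Subshift A ℤ)
    {E : Type*} [PseudoMetricSpace E] {f : Ω.carrier → E} (hf : Continuous f) {ε : ℝ}
    (hε : 0 < ε) :
    ∃ N : ℕ, ∀ u v : Ω.carrier, (∀ i : ℤ, |i| ≤ N → u.1 i = v.1 i) → dist (f u) (f v) < ε := by
  have : CompactSpace Ω.carrier := isCompact_iff_compactSpace.1 Ω.isClosed.isCompact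
  have key : ∃ N : ℕ, ∀ u ∈ (Set.univ : Set Ω.carrier), ∀ v : Ω.carrier,
      (∀ i : ℤ, |i| ≤ N → u.1 i = v.1 i) → dist (f u) (f v) < ε := by
    refine isCompact_univ.induction_on (p := fun s : Set Ω.carrier =>
      ∃ N : ℕ, ∀ u ∈ s, ∀ v : Ω.carrier,
        (∀ i : ℤ, |i| ≤ N → u.1 i = v.1 i) → dist (f u) (f v) < ε) ?_ ?_ ?_ ?_
    · exact ⟨0, by simp⟩
    · rintro s t hst ⟨N, hN⟩
      exact ⟨N, fun u hu => hN u (hst hu)⟩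
    · rintro s t ⟨N, hN⟩ ⟨K, hK⟩
      refine ⟨max N K, fun u hu v huv => ?_⟩
      rcases hu with hu | hu
      · exact hN u hu v fun i hi => huv i (hi.trans (by exact_mod_cast le_max_left N K))
      · exact hK u hu v fun i hi => huv i (hi.trans (by exact_mod_cast le_max_right N K))
    · intro u _
      have h1 : ∀ᶠ v in 𝓝 u, dist (f v) (f u) < ε / 2 :=
        (Metric.tendsto_nhds.1 hf.continuousAt) _ (half_pos hε)
      rw [nhds_subtype_eq_comap, eventually_comap] at h1
      obtain ⟨U, hU, hUo, huU⟩ := eventually_nhds_iff.1 h1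
      obtain ⟨N, hN⟩ : ∃ N : ℕ, ∀ v : ℤ → A, (∀ i : ℤ, |i| ≤ N → v i = u.1 i) → v ∈ U := by
        by_contra! hcon
        choose v hv hvU using hcon
        have := (tendsto_of_forall_abs_le hv).eventually_mem (hUo.mem_nhds huU)
        obtain ⟨n, hn⟩ := this.exists
        exact hvU n hn
      refine ⟨{v | ∀ i : ℤ, |i| ≤ N → v.1 i = u.1 i}, ?_, N, fun v hv v' hvv' => ?_⟩
      · rw [nhdsWithin_univ]
        exact continuous_subtype_val.continuousAt.eventually (eventually_forall_abs_le u.1 N)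
      · have h2 := hU _ (hN v.1 hv) v rfl
        have h3 := hU _ (hN v'.1 fun i hi => (hvv' i hi).symm.trans (hv i hi)) v' rfl
        calc dist (f v) (f v') ≤ dist (f v) (f u) + dist (f v') (f u) := dist_triangle_right _ _ _
          _ < ε := by linarith
  obtain ⟨N, hN⟩ := key
  exact ⟨N, fun u v => hN u trivial v⟩

theorem apply_shift_natCast {Ω : Subshift A ℤ} {η : Circle} {f : Ω.carrier → Circle}
    (hf : ∀ x : Ω.carrier, f ((Ω.mapsTo 1).restrict _ _ _ x) = η * f x) (x : Ω.carrier) (n : ℕ) :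
    f ⟨shift (n : ℤ) x.1, Ω.mapsTo _ x.2⟩ = η ^ n * f x := by
  induction n with
  | zero =>
    rw [pow_zero, one_mul]
    congr 1
    ext i
    simp [shift_apply]
  | succ n ih =>
    rw [pow_succ', mul_assoc, ← ih, ← hf]
    congr 1
    ext i
    simp only [shift_apply, Set.MapsTo.val_restrict_apply, Nat.cast_succ, ← add_assoc]

end SymbolicDynamics.FullShift.Subshift

/-! ### Bounded cocycles over a minimal subshift. -/

section GottschalkHedlund

variable {A : Type*}

/-- The sum of `x` along the orbit of `u`, as an additive cocycle indexed by `ℤ`. -/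
noncomputable def cocycleSum (x : A → ℝ) (u : ℤ → A) (n : ℤ) : ℝ :=
  ∑ i ∈ Finset.Ico 0 n, x (u i) - ∑ i ∈ Finset.Ico n 0, x (u i)

theorem cocycleSum_zero (x : A → ℝ) (u : ℤ → A) : cocycleSum x u 0 = 0 := by simp [cocycleSum]

theorem cocycleSum_add_one (x : A → ℝ) (u : ℤ → A) (n : ℤ) :
    cocycleSum x u (n + 1) = cocycleSum x u n + x (u n) := by
  unfold cocycleSum
  rcases le_or_gt 0 n with hn | hn
  · rw [Finset.Ico_eq_empty (by omega : ¬ n + 1 < 0), Finset.Ico_eq_empty (by omega : ¬ n < 0),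
      show Finset.Ico 0 (n + 1) = insert n (Finset.Ico 0 n) by ext i; simp; omega,
      Finset.sum_insert (by simp)]
    simp only [Finset.sum_empty]
    ring
  · rw [Finset.Ico_eq_empty (by omega : ¬ 0 < n + 1), Finset.Ico_eq_empty (by omega : ¬ 0 < n),
      show Finset.Ico n 0 = insert n (Finset.Ico (n + 1) 0) by ext i; simp; omega,
      Finset.sum_insert (by simp)]
    simp only [Finset.sum_empty]
    ring

theorem cocycleSum_shift (x : A → ℝ) (u : ℤ → A) (p n : ℤ) :
    cocycleSum x (shift p u) n = cocycleSum x u (p + n) - cocycleSum x u p := by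
  induction n using Int.induction_on with
  | zero => simp [cocycleSum_zero]
  | succ n ih => rw [cocycleSum_add_one, ih, ← add_assoc, cocycleSum_add_one, shift_apply]; ring
  | pred n ih =>
    have h1 := cocycleSum_add_one x (shift p u) (-(n : ℤ) - 1)
    have h2 := cocycleSum_add_one x u (p + (-(n : ℤ) - 1))
    rw [sub_add_cancel, shift_apply] at h1
    rw [show p + (-(n : ℤ) - 1) + 1 = p + -n by ring] at h2
    linarith

theorem cocycleSum_congr (x : A → ℝ) {u v : ℤ → A} {N : ℕ} (h : ∀ i : ℤ, |i| ≤ N → u i = v i)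
    {n : ℤ} (hn : |n| ≤ N) : cocycleSum x u n = cocycleSum x v n := by
  have hn' := abs_le.1 hn
  unfold cocycleSum
  congr 1 <;> refine Finset.sum_congr rfl fun i hi => ?_ <;> rw [Finset.mem_Ico] at hi <;>
    rw [h i (abs_le.2 (by omega))]

theorem sum_Ico_eq_sum_biInfFactor (x : A → ℝ) (u : ℤ → A) (m : ℤ) (k : ℕ) :
    ∑ i ∈ Finset.Ico m (m + k), x (u i) = ((biInfFactor u m k).map x).sum := by
  induction k with
  | zero => simp [biInfFactor]
  | succ k ih =>
    rw [biInfFactor_add, List.map_append, List.sum_append, ← ih,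
      show Finset.Ico m (m + (k + 1 : ℕ)) = insert (m + (k : ℤ)) (Finset.Ico m (m + k)) by
        ext i; simp; omega, Finset.sum_insert (by simp), add_comm]
    simp [biInfFactor]

theorem abs_cocycleSum_le {x : A → ℝ} {u : ℤ → A} {B : ℝ}
    (h : ∀ m n, |((biInfFactor u m n).map x).sum| ≤ B) (n : ℤ) : |cocycleSum x u n| ≤ B := by
  unfold cocycleSum
  rcases le_total 0 n with hn | hn
  · obtain ⟨k, rfl⟩ := Int.eq_ofNat_of_zero_le hn
    rw [Finset.Ico_eq_empty (by omega : ¬ (k : ℤ) < 0), Finset.sum_empty, sub_zero]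
    have := sum_Ico_eq_sum_biInfFactor x u 0 k
    rw [zero_add] at this
    rw [this]
    exact h _ _
  · obtain ⟨k, rfl⟩ := Int.exists_eq_neg_ofNat hn
    rw [Finset.Ico_eq_empty (by omega : ¬ 0 < -(k : ℤ)), Finset.sum_empty, zero_sub, abs_neg]
    have := sum_Ico_eq_sum_biInfFactor x u (-k) k
    rw [neg_add_cancel] at this
    rw [this]
    exact h _ _

/-- A form of the Gottschalk–Hedlund theorem: in a minimal subshift, a function of the letter at
the origin with bounded sums is a continuous coboundary. -/
theorem exists_continuous_coboundary [TopologicalSpace A] [DiscreteTopology A] (Ω : Subshift A ℤ)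
    (hmin : ∀ u ∈ Ω.carrier, ∀ v ∈ Ω.carrier, ∀ N : ℕ, ∃ p : ℤ, ∀ i : ℤ, |i| ≤ N →
      u i = v (p + i))
    (x : A → ℝ) {B : ℝ} (hB : ∀ u ∈ Ω.carrier, ∀ m n, |((biInfFactor u m n).map x).sum| ≤ B) :
    ∃ g : Ω.carrier → ℝ, Continuous g ∧
      ∀ u : Ω.carrier, g ((Ω.mapsTo 1).restrict _ _ _ u) = g u + x (u.1 0) := by
  have hF (u : Ω.carrier) (n : ℤ) := abs_le.1 (abs_cocycleSum_le (hB u.1 u.2) n)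
  have hba (u : Ω.carrier) : BddAbove (Set.range (cocycleSum x u.1)) :=
    ⟨B, by rintro _ ⟨n, rfl⟩; exact (hF u n).2⟩
  have hbb (u : Ω.carrier) : BddBelow (Set.range (cocycleSum x u.1)) :=
    ⟨-B, by rintro _ ⟨n, rfl⟩; exact (hF u n).1⟩
  set G : Ω.carrier → ℝ := fun u => ⨆ n, cocycleSum x u.1 n
  set H : Ω.carrier → ℝ := fun u => ⨅ n, cocycleSum x u.1 n
  have hle (u : Ω.carrier) (n : ℤ) : cocycleSum x u.1 n ≤ G u := le_ciSup (hba u) n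
  have hge (u : Ω.carrier) (n : ℤ) : H u ≤ cocycleSum x u.1 n := ciInf_le (hbb u) n
  -- By minimality any window of `u` occurs in `v`, so the oscillation `G - H` of the sums is the
  -- same for all points.
  have hosc (u v : Ω.carrier) (n m : ℤ) :
      cocycleSum x u.1 n - cocycleSum x u.1 m ≤ G v - H v := by
    obtain ⟨p, hp⟩ := hmin u.1 u.2 v.1 v.2 (max n.natAbs m.natAbs)
    have hn : |n| ≤ (max n.natAbs m.natAbs : ℕ) := by rw [Int.abs_eq_natAbs]; omega
    have hm : |m| ≤ (max n.natAbs m.natAbs : ℕ) := by rw [Int.abs_eq_natAbs]; omega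
    have hp' : ∀ i : ℤ, |i| ≤ (max n.natAbs m.natAbs : ℕ) → u.1 i = shift p v.1 i := hp
    rw [cocycleSum_congr x hp' hn, cocycleSum_congr x hp' hm, cocycleSum_shift, cocycleSum_shift]
    linarith [hle v (p + n), hge v (p + m)]
  have happ (u : Ω.carrier) {ε : ℝ} (hε : 0 < ε) :
      (∃ n, G u - ε < cocycleSum x u.1 n) ∧ ∃ m, cocycleSum x u.1 m < H u + ε :=
    ⟨exists_lt_of_lt_ciSup (by change G u - ε < G u; linarith),
      exists_lt_of_ciInf_lt (by change H u < H u + ε; linarith)⟩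
  have hconst (u v : Ω.carrier) : G u - H u ≤ G v - H v := by
    refine le_of_forall_pos_lt_add fun ε hε => ?_
    obtain ⟨⟨n, hn⟩, m, hm⟩ := happ u (half_pos hε)
    linarith [hosc u v n m]
  refine ⟨fun u => -G u, Continuous.neg ?_, fun u => ?_⟩
  -- `G` is lower and `H` upper semicontinuous; their difference being constant, `G` is continuous.
  · refine Metric.continuous_iff'.2 fun u ε hε => ?_
    obtain ⟨⟨n, hn⟩, m, hm⟩ := happ u (half_pos hε)
    have := (continuous_subtype_val.continuousAt (x := u)).eventually
      (eventually_forall_abs_le u.1 (max n.natAbs m.natAbs))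
    filter_upwards [this] with v hv
    have en : cocycleSum x v.1 n = cocycleSum x u.1 n :=
      cocycleSum_congr x hv (by rw [Int.abs_eq_natAbs]; omega)
    have em : cocycleSum x v.1 m = cocycleSum x u.1 m :=
      cocycleSum_congr x hv (by rw [Int.abs_eq_natAbs]; omega)
    rw [Real.dist_eq, abs_lt]
    constructor <;> linarith [hle v n, hge v m, hconst u v, hconst v u]
  · have e (n : ℤ) : cocycleSum x (shift 1 u.1) n = cocycleSum x u.1 (1 + n) - x (u.1 0) := by
      have h1 := cocycleSum_add_one x u.1 0
      rw [zero_add, cocycleSum_zero, zero_add] at h1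
      rw [cocycleSum_shift, h1]
    have : G ((Ω.mapsTo 1).restrict _ _ _ u) = G u - x (u.1 0) := by
      refine le_antisymm (ciSup_le fun n => ?_) (sub_le_iff_le_add.2 (ciSup_le fun n => ?_))
      · rw [Set.MapsTo.val_restrict_apply, e]
        linarith [hle u (1 + n)]
      · have h1 := hle ((Ω.mapsTo 1).restrict _ _ _ u) (n - 1)
        rw [Set.MapsTo.val_restrict_apply, e, add_sub_cancel] at h1
        linarith
    change -G _ = -G u + x (u.1 0)
    rw [this]
    ring

end GottschalkHedlund

/-! ### The subshift as the set of words with admissible factors, and its minimality. -/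

namespace Substitution

variable {A : Type*} {σ : Substitution A}

theorem singleton_infix_of_mem {a : A} {w : List A} (h : a ∈ w) : [a] <:+: w := by
  obtain ⟨s, t, rfl⟩ := List.append_of_mem h
  exact ⟨s, t, by simp⟩

section Subshift

variable [Fintype A] [TopologicalSpace A] [DiscreteTopology A]

variable (σ) in
/-- The subshift of the bi-infinite words all of whose factors are admissible. -/
def languageShift : Subshift A ℤ where
  carrier := {u | ∀ m n, σ.Admissible (biInfFactor u m n)}
  isClosed := by
    have : {u : ℤ → A | ∀ m n, σ.Admissible (biInfFactor u m n)}
        = ⋂ m, ⋂ n, {u | σ.Admissible (biInfFactor u m n)} := by ext; simp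
    rw [this]
    exact isClosed_iInter fun m => isClosed_iInter fun n => (isClopen_setOf_biInfFactor _ m n).1
  mapsTo g u hu m n := by
    rw [biInfFactor_shift]
    exact hu _ _

theorem mapsTo_onBiInf_languageShift :
    Set.MapsTo σ.onBiInf σ.languageShift.carrier σ.languageShift.carrier := by
  intro u hu m n
  obtain ⟨p, q, h⟩ := biInfFactor_onBiInf_infix (σ := σ) u m n
  exact (hu p q).onWord.of_infix h

variable [DecidableEq A]

/-- Long words `σ^k(a)` placed over the central windows make the nested compact sets below
non-empty. -/
theorem IsPrimitive.languageShift_nonempty [Nontrivial A] (h : σ.IsPrimitive) :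
    σ.languageShift.carrier.Nonempty := by
  obtain ⟨a⟩ : Nonempty A := inferInstance
  have hne := IsCompact.nonempty_iInter_of_sequence_nonempty_isCompact_isClosed
    (fun N : ℕ => {u : ℤ → A | σ.Admissible (biInfFactor u (-(N : ℤ)) (2 * N + 1))}) ?_ ?_ ?_ ?_
  · obtain ⟨u, hu⟩ := hne
    refine ⟨u, fun m n => ?_⟩
    refine (Set.mem_iInter.1 hu (m.natAbs + n)).of_infix (biInfFactor_infix _ ?_ ?_) <;>
      rw [Nat.cast_add, Int.natCast_natAbs] <;> have := abs_le.1 (le_refl |m|) <;>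
      push_cast <;> omega
  · intro N u hu
    exact Admissible.of_infix hu (biInfFactor_infix _ (by push_cast; omega) (by push_cast; omega))
  · intro N
    obtain ⟨k, hk⟩ := h.exists_le_length (2 * N + 1)
    have hl := hk k le_rfl a
    set w := σ.onWord^[k] [a] with hw
    -- A copy of `w` starting at `-N`; the letters outside this copy are irrelevant.
    set u : ℤ → A := fun i => w.getD (i + N).toNat a
    have hu : OccursAt u (-(N : ℤ)) w := by
      refine occursAt_iff.2 fun i hi => ?_
      change w.getD (-(N : ℤ) + i + N).toNat a = _
      rw [show (-(N : ℤ) + i + N).toNat = i by omega, List.getD_eq_getElem _ _ hi]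
    have hinf := biInfFactor_infix u (le_refl (-(N : ℤ))) (n := 2 * N + 1) (q := w.length)
      (by omega)
    rw [show biInfFactor u (-(N : ℤ)) w.length = w from hu] at hinf
    exact ⟨u, k, a, hinf⟩
  · exact (isClopen_setOf_biInfFactor _ _ _).1.isCompact
  · exact fun N => (isClopen_setOf_biInfFactor _ _ _).1

/-- For a primitive substitution, all the admissible words occur in each word of the subshift. -/
theorem IsPrimitive.exists_occursAt (h : σ.IsPrimitive) {u : ℤ → A}
    (hu : u ∈ σ.languageShift.carrier) {w : List A} (hw : σ.Admissible w) :
    ∃ p, OccursAt u p w := by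
  obtain ⟨k₀, hk₀⟩ := h.exists_forall_mem
  obtain ⟨k, a, hka⟩ := hw
  have hn (b : A) : w <:+: σ.onWord^[k + k₀] [b] := by
    rw [Function.iterate_add_apply]
    exact hka.trans (σ.iterate_onWord_infix k (singleton_infix_of_mem (hk₀ k₀ le_rfl b a)))
  set n := k + k₀
  set L := ∑ b, (σ.onWord^[n] [b]).length
  have hL (b : A) : (σ.onWord^[n] [b]).length ≤ L :=
    Finset.single_le_sum (f := fun b => (σ.onWord^[n] [b]).length) (fun _ _ => Nat.zero_le _)
      (Finset.mem_univ b)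
  obtain ⟨K, c, hK⟩ := hu 0 (2 * L + 1)
  have hlen : (biInfFactor u 0 (2 * L + 1)).length = 2 * L + 1 := length_biInfFactor _ _ _
  -- The factor is too long for `σ^K(c)` with `K < n`; so it lies in a concatenation of words
  -- `σ^n(b)` and contains one of them, hence `w`.
  have hnK : n ≤ K := by
    by_contra! hlt
    have h1 := hK.length_le
    have h2 := σ.length_iterate_onWord_mono [c] hlt.le
    have h3 := hL c
    simp only at h2
    omega
  obtain ⟨j, rfl⟩ := Nat.exists_eq_add_of_le hnK
  rw [Function.iterate_add_apply, iterate_onWord_flatMap] at hK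
  obtain ⟨b, hb⟩ := List.exists_infix_of_infix_flatMap hL (by omega) hK
  exact (occursAt_biInfFactor u 0 (2 * L + 1)).exists_of_infix ((hn b).trans hb)

/-- For `y` in `Y`, the images `σ^n(y)` stay in `Y` and contain `σ^n(y₀)`, so every admissible word
occurs in `Y`, which is closed and shift-invariant. -/
theorem IsPrimitive.languageShift_subset (h : σ.IsPrimitive) (Y : Subshift A ℤ)
    (hY : Y.carrier.Nonempty) (hσ : Set.MapsTo σ.onBiInf Y.carrier Y.carrier) :
    σ.languageShift.carrier ⊆ Y.carrier := by
  intro u hu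
  refine Y.mem_of_forall_occursAt fun n => ?_
  obtain ⟨y, hy⟩ := hY
  obtain ⟨k, a, hka⟩ := hu (-(n : ℤ)) (2 * n + 1)
  obtain ⟨j, hj⟩ := h.exists_forall_mem
  have h0 := occursAt_iterate_onBiInf (σ := σ) (occursAt_biInfFactor y 0 1) (k + j)
  have h1 : biInfFactor y 0 1 = [y 0] := by simp [biInfFactor]
  rw [h1, Function.iterate_add_apply σ.onWord] at h0
  have h2 := hka.trans (σ.iterate_onWord_infix k (singleton_infix_of_mem (hj j le_rfl (y 0) a)))
  exact ⟨_, hσ.iterate (k + j) hy, h0.exists_of_infix h2⟩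

/-- For a primitive substitution, `Ω_σ` is the set of the bi-infinite words all of whose factors
are admissible. -/
theorem IsPrimitive.carrier_subshift_eq [Nontrivial A] (h : σ.IsPrimitive) :
    σ.subshift.carrier = σ.languageShift.carrier :=
  subset_antisymm
    (Set.biInter_subset_of_mem (⟨h.languageShift_nonempty, mapsTo_onBiInf_languageShift⟩ :
      σ.languageShift ∈ {Y : Subshift A ℤ |
        Y.carrier.Nonempty ∧ Set.MapsTo σ.onBiInf Y.carrier Y.carrier}))
    (Set.subset_iInter₂ fun Y hY => h.languageShift_subset Y hY.1 hY.2)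

/-- The subshift of a primitive substitution is minimal. -/
theorem IsPrimitive.exists_forall_eq (h : σ.IsPrimitive) {u v : ℤ → A}
    (hu : u ∈ σ.languageShift.carrier) (hv : v ∈ σ.languageShift.carrier) (N : ℕ) :
    ∃ p : ℤ, ∀ i : ℤ, |i| ≤ N → u i = v (p + i) := by
  obtain ⟨p, hp⟩ := h.exists_occursAt hv (hu (-(N : ℤ)) (2 * N + 1))
  refine ⟨p + N, fun i hi => ?_⟩
  have hi' := abs_le.1 hi
  have h1 := occursAt_iff.1 hp (i + N).toNat (by rw [length_biInfFactor]; omega)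
  have h2 : (((i + N).toNat : ℕ) : ℤ) = i + N := Int.toNat_of_nonneg (by omega)
  rw [h2] at h1
  rw [show p + N + i = p + (i + N) by ring, h1]
  simp only [biInfFactor, List.getElem_map, List.getElem_range, h2]
  congr 1
  ring

end Subshift

/-! ### Sums of a contracted vector along admissible words. -/

section BoundedSums

variable [Fintype A] [DecidableEq A]

/-- The prefix consists of full words `σ^n(b)`, each costing at most `c`, and then a prefix of one
more such word, costing at most `B`. -/
theorem norm_sum_map_le_of_prefix {x : A → ℂ} {n : ℕ} {B c : ℝ}
    (hc : ∀ a, ‖Matrix.vecMul x (σ.incidenceMatrix.map (Int.cast : ℤ → ℂ) ^ n) a‖ ≤ c)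
    (hB : ∀ a p, p <+: σ.onWord^[n] [a] → ‖(p.map x).sum‖ ≤ B) (hB0 : 0 ≤ B) (hc0 : 0 ≤ c)
    (l p : List A) (h : p <+: σ.onWord^[n] l) : ‖(p.map x).sum‖ ≤ B + l.length * c := by
  induction l generalizing p with
  | nil =>
    rw [iterate_onWord_flatMap, List.flatMap_nil, List.prefix_nil] at h
    simpa [h] using hB0
  | cons b l ih =>
    obtain ⟨t, ht⟩ := h
    rw [show b :: l = [b] ++ l from rfl, iterate_onWord_append, List.append_eq_append_iff] at ht
    rw [List.length_cons]
    push_cast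
    rcases ht with ⟨r, hr, -⟩ | ⟨r, hr, hr'⟩
    · have h1 := hB b p ⟨r, hr.symm⟩
      have : 0 ≤ ((l.length : ℝ) + 1) * c := by positivity
      linarith
    · rw [hr, List.map_append, List.sum_append, sum_map_iterate_onWord]
      have h1 := ih r ⟨t, hr'.symm⟩
      have h2 := hc b
      refine (norm_add_le _ _).trans ?_
      rw [List.map_singleton, List.sum_singleton]
      linarith

/-- If `x` is contracted by the powers of the incidence matrix in a summable way, then the sums of
`x` along the admissible words are bounded. -/
theorem exists_forall_norm_sum_map_le {x : A → ℂ}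
    (hx : ∀ a, Summable fun n : ℕ =>
      ‖Matrix.vecMul x (σ.incidenceMatrix.map (Int.cast : ℤ → ℂ) ^ n) a‖) :
    ∃ B, ∀ w, σ.Admissible w → ‖(w.map x).sum‖ ≤ B := by
  set c : ℕ → ℝ := fun n =>
    ∑ a, ‖Matrix.vecMul x (σ.incidenceMatrix.map (Int.cast : ℤ → ℂ) ^ n) a‖ with hcdef
  have hcs : Summable c := summable_sum fun a _ => hx a
  have hc0 (n : ℕ) : 0 ≤ c n := Finset.sum_nonneg fun _ _ => norm_nonneg _
  have hc (n : ℕ) (a : A) :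
      ‖Matrix.vecMul x (σ.incidenceMatrix.map (Int.cast : ℤ → ℂ) ^ n) a‖ ≤ c n :=
    Finset.single_le_sum (f := fun a =>
      ‖Matrix.vecMul x (σ.incidenceMatrix.map (Int.cast : ℤ → ℂ) ^ n) a‖)
      (fun _ _ => norm_nonneg _) (Finset.mem_univ a)
  set L := ∑ a, (σ.image a).length
  have hL (a : A) : (σ.image a).length ≤ L :=
    Finset.single_le_sum (f := fun a => (σ.image a).length) (fun _ _ => Nat.zero_le _)
      (Finset.mem_univ a)
  have hpre (n : ℕ) : ∀ a p, p <+: σ.onWord^[n] [a] →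
      ‖(p.map x).sum‖ ≤ c 0 + L * ∑ k ∈ Finset.range n, c k := by
    induction n with
    | zero =>
      intro a p hp
      rw [Function.iterate_zero, id_eq] at hp
      obtain ⟨t, ht⟩ := hp
      rcases List.append_eq_singleton_iff.1 ht with ⟨rfl, -⟩ | ⟨rfl, -⟩
      · simpa using hc0 0
      · simpa using hc 0 a
    | succ n ih =>
      intro a p hp
      rw [iterate_succ_onWord_singleton] at hp
      have h1 := norm_sum_map_le_of_prefix (hc n) ih
        (add_nonneg (hc0 0) (mul_nonneg (Nat.cast_nonneg _) (Finset.sum_nonneg fun k _ => hc0 k)))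
        (hc0 n) _ p hp
      have h2 : ((σ.image a).length : ℝ) * c n ≤ L * c n :=
        mul_le_mul_of_nonneg_right (by exact_mod_cast hL a) (hc0 n)
      rw [Finset.sum_range_succ, mul_add]
      linarith
  set B := c 0 + L * ∑' k, c k
  have hpreB (n : ℕ) (a : A) (p : List A) (hp : p <+: σ.onWord^[n] [a]) :
      ‖(p.map x).sum‖ ≤ B := by
    refine (hpre n a p hp).trans ?_
    exact add_le_add_right (mul_le_mul_of_nonneg_left
      (hcs.sum_le_tsum (Finset.range n) fun k _ => hc0 k) (Nat.cast_nonneg _)) _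
  -- A factor is the difference of two prefixes.
  refine ⟨B + B, fun w ⟨n, a, s, t, h⟩ => ?_⟩
  have h1 := hpreB n a s ⟨w ++ t, by rw [← h, List.append_assoc]⟩
  have h2 := hpreB n a (s ++ w) ⟨t, h⟩
  have h3 : (w.map x).sum = ((s ++ w).map x).sum - (s.map x).sum := by
    rw [List.map_append, List.sum_append, add_sub_cancel_left]
  rw [h3]
  exact (norm_sub_le _ _).trans (add_le_add h2 h1)

end BoundedSums

/-! ### Proper substitutions and Host's condition. -/

section Proper

/-- For a proper substitution, the word `σ^n(u)` looks the same around the origin and after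
`σ^n(u₀)`. -/
theorem IsProper.iterate_onBiInf_apply_eq (h : σ.IsProper) {n N : ℕ}
    (hN : ∀ a, N + 1 ≤ (σ.onWord^[n] [a]).length) (u : ℤ → A) {i : ℤ} (hi : |i| ≤ N) :
    σ.onBiInf^[n + 1] u i
      = σ.onBiInf^[n + 1] u ((σ.onWord^[n + 1] [u 0]).length + i) := by
  obtain ⟨⟨a, ha⟩, b, hb⟩ := h
  -- All words `σ^(n+1)(c)` start with `σ^n(a)` and end with `σ^n(b)`, so the two cuts have the same
  -- neighbourhoods; this costs one extra iterate.
  have hpre (c : A) : ∃ t, σ.onWord^[n + 1] [c] = σ.onWord^[n] [a] ++ t := by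
    obtain ⟨t, ht⟩ := ha c
    exact ⟨σ.onWord^[n] t, by
      rw [iterate_succ_onWord_singleton, ← ht, iterate_onWord_append]⟩
  have hsuf (c : A) : ∃ t, σ.onWord^[n + 1] [c] = t ++ σ.onWord^[n] [b] := by
    obtain ⟨t, ht⟩ := hb c
    exact ⟨σ.onWord^[n] t, by
      rw [iterate_succ_onWord_singleton, ← ht, iterate_onWord_append]⟩
  set y := σ.onBiInf^[n + 1] u with hy
  have hright : OccursAt y 0 (σ.onWord^[n + 1] [u 0] ++ σ.onWord^[n + 1] [u 1]) := by
    have h1 := occursAt_iterate_onBiInf (σ := σ) (occursAt_biInfFactor u 0 2) (n + 1)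
    have h2 : biInfFactor u 0 2 = [u 0] ++ [u 1] := by simp [biInfFactor, List.range_succ]
    rwa [h2, iterate_onWord_append] at h1
  have hleft : OccursAt y (-((σ.onWord^[n + 1] [u (-1)]).length : ℤ))
      (σ.onWord^[n + 1] [u (-1)]) := by
    refine occursAt_iterate_onBiInf_neg ?_ (n + 1)
    simp [OccursAt, biInfFactor]
  set p := (σ.onWord^[n + 1] [u 0]).length with hp
  obtain ⟨hr0, hr1⟩ := occursAt_append.1 hright
  rw [← hp, zero_add] at hr1
  have hi' := abs_le.1 hi
  rcases le_or_gt 0 i with h0 | h0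
  · obtain ⟨t0, ht0⟩ := hpre (u 0)
    obtain ⟨t1, ht1⟩ := hpre (u 1)
    rw [ht0] at hr0
    rw [ht1] at hr1
    have e0 := occursAt_iff.1 (occursAt_append.1 hr0).1 i.toNat (by have := hN a; omega)
    have e1 := occursAt_iff.1 (occursAt_append.1 hr1).1 i.toNat (by have := hN a; omega)
    rw [Int.toNat_of_nonneg h0] at e0 e1
    rw [zero_add] at e0
    rw [e0, e1]
  · obtain ⟨t0, ht0⟩ := hsuf (u 0)
    obtain ⟨t1, ht1⟩ := hsuf (u (-1))
    rw [ht0, List.length_append] at hp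
    rw [ht0] at hr0
    rw [ht1, List.length_append] at hleft
    set l := (σ.onWord^[n] [b]).length with hl
    have hNl := hN b
    have e0 := occursAt_iff.1 (occursAt_append.1 hr0).2 (i + l).toNat (by omega)
    have e1 := occursAt_iff.1 (occursAt_append.1 hleft).2 (i + l).toNat (by omega)
    rw [Int.toNat_of_nonneg (by omega)] at e0 e1
    rw [show -((t1.length + l : ℕ) : ℤ) + t1.length + (i + l) = i by push_cast; ring] at e1
    rw [show 0 + (t0.length : ℤ) + (i + l) = p + i by rw [hp]; push_cast; ring] at e0
    rw [e0, e1]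

/-- Host's condition: if `η` is an eigenvalue of a subshift invariant under a proper substitution,
then `η ^ |σ^n(a)|` tends to `1`. -/
theorem IsProper.tendsto_pow_length [Fintype A] [DecidableEq A] [Nontrivial A]
    [TopologicalSpace A] [DiscreteTopology A] (hproper : σ.IsProper) (hprim : σ.IsPrimitive)
    {Ω : Subshift A ℤ} (hΩ : Set.MapsTo σ.onBiInf Ω.carrier Ω.carrier) {η : Circle}
    (hη : Ω.IsEigenvalue η) {u : ℤ → A} (hu : u ∈ Ω.carrier) :
    Tendsto (fun n => η ^ (σ.onWord^[n] [u 0]).length) atTop (𝓝 1) := by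
  obtain ⟨f, hf, hfη⟩ := hη
  refine Metric.tendsto_atTop.2 fun ε hε => ?_
  obtain ⟨N, hN⟩ := Ω.exists_forall_dist_lt hf hε
  obtain ⟨k, hk⟩ := hprim.exists_le_length (N + 1)
  refine ⟨k + 1, fun n hn => ?_⟩
  obtain ⟨m, rfl⟩ := Nat.exists_eq_add_of_le' (Nat.le_of_succ_le hn)
  obtain ⟨m, rfl⟩ : ∃ j, m = j + 1 := ⟨m - 1, by omega⟩
  have hy := hΩ.iterate (m + k + 1) hu
  -- The two points agree near the origin, so `f` nearly agrees on them, while it differs by the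
  -- factor `η^|σ^n(u₀)|`.
  have h1 := hN ⟨_, Ω.mapsTo ((σ.onWord^[m + k + 1] [u 0]).length : ℤ) hy⟩ ⟨_, hy⟩ fun i hi =>
    (hproper.iterate_onBiInf_apply_eq (hk (m + k) (by omega)) u hi).symm
  rw [Subshift.apply_shift_natCast hfη ⟨_, hy⟩] at h1
  rw [show m + 1 + k = m + k + 1 by omega]
  refine lt_of_eq_of_lt ?_ h1
  simpa using (Circle.dist_mul_right (η ^ (σ.onWord^[m + k + 1] [u 0]).length) 1 (f ⟨_, hy⟩)).symm

end Proper

end Substitution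

/-! ### The two implications and the one-letter case. -/

namespace Substitution

variable {A : Type*} {σ : Substitution A} [Fintype A] [DecidableEq A] [TopologicalSpace A]

/-- Lengths may fail to grow here. The subshift is a point and `M` is a positive integer, so both
sides say that `α` is an integer. -/
theorem isEigenvalue_iff_of_subsingleton [Subsingleton A] (hproper : σ.IsProper) (α : ℝ) :
    σ.subshift.IsEigenvalue (Circle.exp (2 * Real.pi * α)) ↔
      ∃ w : A → ℤ, ∀ β : ℂ, 1 ≤ ‖β‖ → ∀ v : A → ℂ,
        IsGeneralizedEigenvector (σ.incidenceMatrix.map (Int.cast : ℤ → ℂ)) β v →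
          (fun a => (w a : ℂ)) ⬝ᵥ v = (fun _ => (α : ℂ)) ⬝ᵥ v := by
  obtain ⟨a, ha⟩ := hproper.1
  constructor
  · rintro ⟨f, -, hf⟩
    have hu : (fun _ => a) ∈ σ.subshift.carrier :=
      Set.mem_iInter₂.2 fun Y hY => by
        obtain ⟨y, hy⟩ := hY.1
        rwa [Subsingleton.elim y fun _ => a] at hy
    have h1 := hf ⟨_, hu⟩
    rw [Subsingleton.elim ((σ.subshift.mapsTo 1).restrict _ _ _ _) ⟨_, hu⟩] at h1
    have h2 : Circle.exp (2 * Real.pi * α) = 1 := right_eq_mul.1 h1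
    have h3 := Circle.four_mul_abs_sub_round_le α
    rw [h2, dist_self] at h3
    have h4 : α = round α :=
      sub_eq_zero.1 (abs_eq_zero.1 (le_antisymm (by linarith) (abs_nonneg _)))
    refine ⟨fun _ => round α, fun β _ v _ => ?_⟩
    congr 1
    ext
    exact_mod_cast h4.symm
  · rintro ⟨w, hw⟩
    have hM (b c : A) : σ.incidenceMatrix b c = σ.incidenceMatrix a a := by
      rw [Subsingleton.elim b a, Subsingleton.elim c a]
    have hpos : 1 ≤ σ.incidenceMatrix a a := by
      have : 0 < (σ.image a).count a := List.count_pos_iff.2 ((ha a).subset (by simp))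
      simp only [incidenceMatrix, Matrix.of_apply]
      omega
    have : Unique A := uniqueOfSubsingleton a
    have h1 := hw (σ.incidenceMatrix a a) (by
        rw [Complex.norm_intCast]
        exact_mod_cast hpos.trans (le_abs_self _)) (fun _ => 1)
      ⟨fun h0 => one_ne_zero (congrFun h0 a), pow_rootMultiplicity_mulVec_eq_zero _ _ 1 _ (by
        rw [pow_one, Matrix.sub_mulVec, Matrix.scalar_apply, Matrix.diagonal_const_mulVec]
        ext b
        simp [Matrix.mulVec, dotProduct, hM])⟩
    have h2 : (w default : ℝ) = α := by
      simp only [dotProduct, Fintype.sum_unique, mul_one] at h1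
      exact_mod_cast h1
    refine ⟨fun _ => 1, continuous_const, fun _ => ?_⟩
    rw [← h2, Circle.exp_two_pi_mul_int, mul_one]

variable [DiscreteTopology A]

theorem exists_weight_of_isEigenvalue [Nontrivial A] (hprim : σ.IsPrimitive)
    (hproper : σ.IsProper) (hpu : σ.IsPseudoUnimodular) {α : ℝ}
    (h : σ.subshift.IsEigenvalue (Circle.exp (2 * Real.pi * α))) :
    ∃ w : A → ℤ, ∀ β : ℂ, 1 ≤ ‖β‖ → ∀ v : A → ℂ,
      IsGeneralizedEigenvector (σ.incidenceMatrix.map (Int.cast : ℤ → ℂ)) β v →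
        (fun a => (w a : ℂ)) ⬝ᵥ v = (fun _ => (α : ℂ)) ⬝ᵥ v := by
  refine exists_int_dotProduct_eq_of_tendsto _ hpu _
    (fun n a => round (α * (σ.onWord^[n] [a]).length)) (tendsto_pi_nhds.2 fun a => ?_)
  obtain ⟨u, hu⟩ := hprim.languageShift_nonempty
  obtain ⟨p, hp⟩ := hprim.exists_occursAt hu ⟨0, a, List.infix_rfl⟩
  have hp0 := occursAt_iff.1 hp 0 (by simp)
  have hmaps : Set.MapsTo σ.onBiInf σ.subshift.carrier σ.subshift.carrier := by
    rw [hprim.carrier_subshift_eq]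
    exact mapsTo_onBiInf_languageShift
  -- Host's condition concerns the letter at the origin; shifting to an occurrence of `a` reaches
  -- every letter.
  have hlim := hproper.tendsto_pow_length hprim hmaps h
    (σ.subshift.mapsTo p (hprim.carrier_subshift_eq ▸ hu))
  have hu0 : shift p u 0 = a := by simpa [shift_apply] using hp0
  rw [hu0] at hlim
  have hlim' := (tendsto_iff_dist_tendsto_zero.1 hlim).div_const 4
  rw [zero_div] at hlim'
  refine tendsto_zero_iff_norm_tendsto_zero.2
    (squeeze_zero (fun _ => norm_nonneg _) (fun n => ?_) hlim')
  have h1 := Circle.four_mul_abs_sub_round_le (α * (σ.onWord^[n] [a]).length)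
  have h2 : Circle.exp (2 * Real.pi * (α * (σ.onWord^[n] [a]).length))
      = Circle.exp (2 * Real.pi * α) ^ (σ.onWord^[n] [a]).length := by
    rw [← Circle.exp_natCast_mul]
    congr 1
    ring
  rw [h2] at h1
  have h3 := σ.sum_map_iterate_onWord (fun _ => (α : ℂ)) n [a]
  rw [List.map_const', List.sum_replicate, List.map_singleton, List.sum_singleton] at h3
  rw [Pi.sub_apply, ← h3, nsmul_eq_mul]
  have h4 : ((σ.onWord^[n] [a]).length : ℂ) * (α : ℂ)
        - (round (α * (σ.onWord^[n] [a]).length) : ℤ)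
      = ((α * (σ.onWord^[n] [a]).length - round (α * (σ.onWord^[n] [a]).length) : ℝ) : ℂ) := by
    push_cast
    ring
  rw [h4, Complex.norm_real, Real.norm_eq_abs]
  linarith

theorem isEigenvalue_of_weight [Nontrivial A] (hprim : σ.IsPrimitive) {α : ℝ} (w : A → ℤ)
    (hw : ∀ β : ℂ, 1 ≤ ‖β‖ → ∀ v : A → ℂ,
      IsGeneralizedEigenvector (σ.incidenceMatrix.map (Int.cast : ℤ → ℂ)) β v →
        (fun a => (w a : ℂ)) ⬝ᵥ v = (fun _ => (α : ℂ)) ⬝ᵥ v) :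
    σ.subshift.IsEigenvalue (Circle.exp (2 * Real.pi * α)) := by
  obtain ⟨B, hB⟩ := exists_forall_norm_sum_map_le (σ := σ)
    (x := (fun a => (w a : ℂ)) - fun _ => (α : ℂ)) (summable_vecMul_pow fun β hβ v hv => by
      rw [sub_dotProduct, hw β hβ v hv, sub_self])
  have hcarrier := hprim.carrier_subshift_eq
  obtain ⟨g, hg, hgS⟩ := exists_continuous_coboundary σ.subshift
    (fun u hu v hv N => hprim.exists_forall_eq (hcarrier ▸ hu) (hcarrier ▸ hv) N)
    (fun a => (w a : ℝ) - α) (B := B) (fun u hu m n => by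
      rw [hcarrier] at hu
      convert hB _ (hu m n) using 1
      rw [← Real.norm_eq_abs, ← Complex.norm_real, ← Complex.ofRealHom_eq_coe, map_list_sum,
        List.map_map]
      congr 3
      ext a
      simp)
  -- Since `g` increases by `w(u₀) - α` under the shift, the sign makes the factor `exp(2πiα)`; the
  -- integer `w(u₀)` disappears.
  refine ⟨fun u => Circle.exp (-(2 * Real.pi * g u)), by fun_prop, fun u => ?_⟩
  beta_reduce
  rw [hgS, ← Circle.exp_add]
  have e : -(2 * Real.pi * (g u + ((w (u.1 0) : ℝ) - α)))
      = (2 * Real.pi * α + -(2 * Real.pi * g u)) + ((-w (u.1 0) : ℤ) : ℝ) * (2 * Real.pi) := by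
    push_cast
    ring
  rw [e, Circle.exp_add, Circle.exp_int_mul_two_pi, mul_one]

end Substitution

/-- Generalized eigenvectors are stable under non-zero scaling, so a non-zero sum can be normalized
to one. -/
theorem forall_isGeneralizedEigenvector_iff {A : Type*} [Fintype A] [DecidableEq A]
    (M : Matrix A A ℂ) (w : A → ℤ) (α : ℝ) (β : ℂ) :
    (∀ v, IsGeneralizedEigenvector M β v →
      (fun a => (w a : ℂ)) ⬝ᵥ v = (fun _ => (α : ℂ)) ⬝ᵥ v) ↔
    ∀ v, IsGeneralizedEigenvector M β v →
      (∑ a, v a = 1 → ∑ a, (w a : ℂ) * v a = (α : ℂ)) ∧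
      (∑ a, v a = 0 → ∑ a, (w a : ℂ) * v a = 0) := by
  have hα (v : A → ℂ) : (fun _ => (α : ℂ)) ⬝ᵥ v = α * ∑ a, v a := by
    rw [dotProduct, Finset.mul_sum]
  constructor
  · intro h v hv
    have h1 := h v hv
    rw [hα, dotProduct] at h1
    exact ⟨fun e => by rw [h1, e, mul_one], fun e => by rw [h1, e, mul_zero]⟩
  · intro h v hv
    rw [hα]
    by_cases h0 : ∑ a, v a = 0
    · rw [h0, mul_zero]
      exact (h v hv).2 h0
    · have h1 := (h ((∑ a, v a)⁻¹ • v) ⟨smul_ne_zero (inv_ne_zero h0) hv.1, by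
        rw [Matrix.mulVec_smul, hv.2, smul_zero]⟩).1 (by
          simp only [Pi.smul_apply, smul_eq_mul]
          rw [← Finset.mul_sum, inv_mul_cancel₀ h0])
      have h2 : (fun a => (w a : ℂ)) ⬝ᵥ ((∑ a, v a)⁻¹ • v) = α := h1
      rw [dotProduct_smul, smul_eq_mul, inv_mul_eq_iff_eq_mul₀ h0] at h2
      rw [h2, mul_comm]

theorem mainTheorem4 {A : Type*} [Fintype A] [DecidableEq A] [TopologicalSpace A]
    [DiscreteTopology A] (σ : Substitution A) (hprim : σ.IsPrimitive) (hproper : σ.IsProper)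
    (hpu : σ.IsPseudoUnimodular) (α : ℝ) :
    σ.subshift.IsEigenvalue (Circle.exp (2 * Real.pi * α)) ↔
      ∃ w : A → ℤ, ∀ β : ℂ, 1 ≤ ‖β‖ → ∀ v : A → ℂ,
        IsGeneralizedEigenvector (σ.incidenceMatrix.map (Int.cast : ℤ → ℂ)) β v →
          (∑ a, v a = 1 → ∑ a, (w a : ℂ) * v a = (α : ℂ)) ∧
          (∑ a, v a = 0 → ∑ a, (w a : ℂ) * v a = 0) := by
  simp only [← forall_isGeneralizedEigenvector_iff]
  rcases subsingleton_or_nontrivial A with hA | hA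
  · exact Substitution.isEigenvalue_iff_of_subsingleton hproper α
  · exact ⟨fun h => Substitution.exists_weight_of_isEigenvalue hprim hproper hpu h,
      fun ⟨w, hw⟩ => Substitution.isEigenvalue_of_weight hprim w hw⟩
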